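/- Let $\mathcal P=\langle\Sigma\mid\mathcal R\rangle$ be a semigroup presentation ($\mathcal R$ is a set of pairs of words of $\Sigma^+$ such that $u=v\in\mathcal R$ implies $v=u\notin\mathcal R$), and let $w\in\Sigma^+$. Semigroup diagrams over $\mathcal P$ are considered up to isotopy; $\epsilon(x)$ is the trivial diagram on a (possibly empty) word $x$, $\Delta_1\circ\Delta_2$ denotes concatenation, $\Delta_1\cdot\Delta_2$ the reduced form of $\Delta_1\circ\Delta_2$, $\Delta_1+\Delta_2$ the sum, $\Delta^{-1}$ the mirror image, and $\Delta\le D$ means that $\Delta$ is a prefix of $D$, i.e. $D=\Delta\circ E$ for some $E$. A diagram with one cell is atomic, and a diagram is thin if it is a sum of atomic diagrams (or trivial). The diagram group $D(\mathcal P,x)$ consists of the reduced $(x,x)$-diagrams with the product $\cdot$. The Farley complex $X(\mathcal P,w)$ is the cube complex whose vertices are the reduced diagrams with top label $w$ and whose $n$-cubes are spanned by the sets $\{V\cdot Q\mid Q\le\Gamma\}$, where $V$ is a vertex and $\Gamma$ a thin diagram with $n$ cells and $\mathrm{top}(\Gamma)=\mathrm{bot}(V)$; $D(\mathcal P,w)$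 acts on it by left multiplication. A hyperplane is a class of edges for the equivalence relation generated by being parallel sides of a square. For a hyperplane $J$, let $J^+$ be the halfspace of $J$ (connected component of the complex cut along $J$) that does not contain $\epsilon(w)$. A diagram is minimal if its maximal thin suffix has exactly one cell, and the minimal diagram associated with $J$ is the minimal reduced diagram $\Delta$ with $J^+=\{D\mid\Delta\le D\}$. **Proposition 2.6.** Let $J$ be a hyperplane of $X(\mathcal P,w)$ and $\Delta$ its associated minimal diagram. Write the maximal thin suffix of $\Delta$ as $F=\epsilon(a)+\Pi+\epsilon(b)$, where $a,b$ are possibly empty words and $\Pi$ is a single $(u,v)$-cell ($u=v$ or $v=u$ belongs to $\mathcal R$), and let $\overline\Delta$ be the diagram obtained from $\Delta$ by removing $F$, so that $\Delta=\overline\Delta\circ F$, $\mathrm{bot}(\overline\Delta)=aub$ and $\mathrm{bot}(\Delta)=avb$. Suppose that there is no word $\xi\in\Sigma^+$ with $a=au\xi$ modulo $\mathcal P$. Then $$\mathrm{stab}(J)=\overline\Delta\cdot\bigl(D(\mathcal P,a)\times D(\mathcal P,b)\bigr)\cdot\overline\Delta^{-1},$$ where $\mathrm{stab}(J)$ is the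 stabilizer of $J$ in $D(\mathcal P,w)$ and $D(\mathcal P,a)\times D(\mathcal P,b)$ is the canonical subgroup of $D(\mathcal P,aub)$, the image of the injective homomorphism $(A,B)\mapsto A+\epsilon(u)+B$. -/

import Mathlib

/-- A semigroup presentation `⟨α | rel⟩`: the relations are pairs of nonempty words, and at most
one of `u = v`, `v = u` is a relation (in particular `u = u` never is).  Words are lists, the
free semigroup `α⁺` consists of the nonempty ones. -/
structure SemigroupPresentation (α : Type*) where
  rel : Set (List α × List α)
  ne_nil : ∀ {u v : List α}, (u, v) ∈ rel → u ≠ [] ∧ v ≠ []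
  asymm : ∀ {u v : List α}, (u, v) ∈ rel → (v, u) ∉ rel

/-- An elementary derivation step `left · top · right ⟶ left · bot · right`; it is the picture
`ε(left) + Π + ε(right)` of a single cell `Π` with top label `top` and bottom label `bot`. -/
@[ext] structure DerivStep (α : Type*) where
  left : List α
  top : List α
  bot : List α
  right : List α

namespace DerivStep

variable {α : Type*}

def inv (e : DerivStep α) : DerivStep α := ⟨e.left, e.bot, e.top, e.right⟩

def addRight (z : List α) (e : DerivStep α) : DerivStep α := ⟨e.left, e.top, e.bot, e.right ++ z⟩

def addLeft (z : List α) (e : DerivStep α) : DerivStep α := ⟨z ++ e.left, e.top, e.bot, e.right⟩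

/-- Two consecutive steps that act on disjoint subwords are performed in the other order.  The
associated planar diagrams are isotopic. -/
inductive Exchange : List (DerivStep α) → List (DerivStep α) → Prop
  | mk (L M : List (DerivStep α)) (p u v q u' v' r : List α) :
      Exchange (L ++ ⟨p, u, v, q ++ u' ++ r⟩ :: ⟨p ++ v ++ q, u', v', r⟩ :: M)
        (L ++ ⟨p ++ u ++ q, u', v', r⟩ :: ⟨p, u, v, q ++ v' ++ r⟩ :: M)

theorem Exchange.append {L M : List (DerivStep α)} (h : Exchange L M) (A B : List (DerivStep α)) :
    Exchange (A ++ L ++ B) (A ++ M ++ B) := by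
  cases h with
  | mk L M p u v q u' v' r =>
    simpa using Exchange.mk (A ++ L) (M ++ B) p u v q u' v' r

theorem Exchange.map_addRight {L M : List (DerivStep α)} (h : Exchange L M) (z : List α) :
    Exchange (L.map (addRight z)) (M.map (addRight z)) := by
  cases h with
  | mk L M p u v q u' v' r =>
    simpa [addRight] using
      Exchange.mk (L.map (addRight z)) (M.map (addRight z)) p u v q u' v' (r ++ z)

theorem Exchange.map_addLeft {L M : List (DerivStep α)} (h : Exchange L M) (z : List α) :
    Exchange (L.map (addLeft z)) (M.map (addLeft z)) := by
  cases h with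
  | mk L M p u v q u' v' r =>
    simpa [addLeft] using
      Exchange.mk (L.map (addLeft z)) (M.map (addLeft z)) (z ++ p) u v q u' v' r

theorem Exchange.mirror {L M : List (DerivStep α)} (h : Exchange L M) :
    Exchange (M.map inv).reverse (L.map inv).reverse := by
  cases h with
  | mk L M p u v q u' v' r =>
    simpa [inv] using
      Exchange.mk (M.map inv).reverse (L.map inv).reverse p v u q v' u' r

theorem Exchange.length {L M : List (DerivStep α)} (h : Exchange L M) : L.length = M.length := by
  cases h; simp

end DerivStep

namespace SemigroupPresentation

open DerivStep

variable {α : Type*} (P : SemigroupPresentation α)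

/-- There is a `(u, v)`-cell: `u = v` or `v = u` is a relation. -/
def IsCell (u v : List α) : Prop := (u, v) ∈ P.rel ∨ (v, u) ∈ P.rel

/-- Equality of words modulo `P`: the congruence generated by the relations.  (As both sides of
every relation are nonempty, the empty word is only equal to itself.) -/
def EqMod (x y : List α) : Prop :=
  conGen (fun s t : FreeMonoid α => (s.toList, t.toList) ∈ P.rel)
    (FreeMonoid.ofList x) (FreeMonoid.ofList y)

theorem IsCell.symm {P : SemigroupPresentation α} {u v : List α} (h : P.IsCell u v) :
    P.IsCell v u := Or.symm h

theorem IsCell.ne {P : SemigroupPresentation α} {u v : List α} (h : P.IsCell u v) : u ≠ v := by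
  rintro rfl
  rcases h with h | h <;> exact P.asymm h h

/-- `L` is a derivation over `P` from the word `x` to the word `y`. -/
def IsDerivation : List α → List (DerivStep α) → List α → Prop
  | x, [], y => x = y
  | x, e :: L, y => P.IsCell e.top e.bot ∧ x = e.left ++ e.top ++ e.right ∧
      IsDerivation (e.left ++ e.bot ++ e.right) L y

theorem IsDerivation.append {P : SemigroupPresentation α} {x y z : List α}
    {L M : List (DerivStep α)} (hL : P.IsDerivation x L y) (hM : P.IsDerivation y M z) :
    P.IsDerivation x (L ++ M) z := by
  induction L generalizing x with
  | nil => cases hL; exact hM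
  | cons e L ih => exact ⟨hL.1, hL.2.1, ih hL.2.2⟩

theorem IsDerivation.addRight {P : SemigroupPresentation α} {x y : List α}
    {L : List (DerivStep α)} (h : P.IsDerivation x L y) (z : List α) :
    P.IsDerivation (x ++ z) (L.map (DerivStep.addRight z)) (y ++ z) := by
  induction L generalizing x with
  | nil => cases h; rfl
  | cons e L ih =>
    obtain ⟨h1, rfl, h3⟩ := h
    exact ⟨h1, by simp [DerivStep.addRight], by simpa [DerivStep.addRight] using ih h3⟩

theorem IsDerivation.addLeft {P : SemigroupPresentation α} {x y : List α}
    {L : List (DerivStep α)} (h : P.IsDerivation x L y) (z : List α) :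
    P.IsDerivation (z ++ x) (L.map (DerivStep.addLeft z)) (z ++ y) := by
  induction L generalizing x with
  | nil => cases h; rfl
  | cons e L ih =>
    obtain ⟨h1, rfl, h3⟩ := h
    exact ⟨h1, by simp [DerivStep.addLeft], by simpa [DerivStep.addLeft] using ih h3⟩

theorem IsDerivation.mirror {P : SemigroupPresentation α} {x y : List α}
    {L : List (DerivStep α)} (h : P.IsDerivation x L y) :
    P.IsDerivation y (L.map DerivStep.inv).reverse x := by
  induction L generalizing x with
  | nil => cases h; rfl
  | cons e L ih =>
    obtain ⟨h1, rfl, h3⟩ := h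
    rw [List.map_cons, List.reverse_cons]
    exact (ih h3).append ⟨h1.symm, rfl, rfl⟩

/-- Semigroup `(x, y)`-diagrams over `P`, up to isotopy.  Every semigroup diagram is a
concatenation of atomic diagrams, i.e. it is drawn by a derivation; two derivations draw isotopic
diagrams exactly when one is turned into the other by exchanging consecutive independent steps. -/
def Diagram (x y : List α) : Type _ :=
  Quot fun L M : {L : List (DerivStep α) // P.IsDerivation x L y} => Exchange L.1 M.1

namespace Diagram

variable {P}

/-- The trivial diagram `ε(x)`. -/
def trivial (P : SemigroupPresentation α) (x : List α) : P.Diagram x x := Quot.mk _ ⟨[], rfl⟩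

/-- The diagram that consists of a single `(u, v)`-cell. -/
def cell {u v : List α} (h : P.IsCell u v) : P.Diagram u v :=
  Quot.mk _ ⟨[⟨[], u, v, []⟩], h, by simp, by simp [IsDerivation]⟩

/-- The number of cells. -/
def numCells {x y : List α} (D : P.Diagram x y) : ℕ :=
  Quot.lift (fun L => L.1.length) (fun _ _ h => h.length) D

/-- The concatenation `D ∘ E`: the bottom path of `D` is glued to the top path of `E`. -/
def comp {x y z : List α} (D : P.Diagram x y) (E : P.Diagram y z) : P.Diagram x z :=
  Quot.map₂ (fun L M => ⟨L.1 ++ M.1, L.2.append M.2⟩)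
    (fun L _ _ h => by simpa using h.append L.1 [])
    (fun _ _ M h => by simpa using h.append [] M.1) D E

/-- `D + ε(z)`. -/
def addTrivial {x y : List α} (D : P.Diagram x y) (z : List α) : P.Diagram (x ++ z) (y ++ z) :=
  Quot.map (fun L => ⟨L.1.map (DerivStep.addRight z), L.2.addRight z⟩)
    (fun _ _ h => h.map_addRight z) D

/-- `ε(z) + D`. -/
def trivialAdd (z : List α) {x y : List α} (D : P.Diagram x y) : P.Diagram (z ++ x) (z ++ y) :=
  Quot.map (fun L => ⟨L.1.map (DerivStep.addLeft z), L.2.addLeft z⟩)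
    (fun _ _ h => h.map_addLeft z) D

/-- The sum `D + E`: the rightmost vertex of `D` is glued to the leftmost vertex of `E`.  It is
drawn by first drawing `D` and then `E`. -/
def sum {x y x' y' : List α} (D : P.Diagram x y) (E : P.Diagram x' y') :
    P.Diagram (x ++ x') (y ++ y') :=
  (D.addTrivial x').comp (trivialAdd y E)

/-- The mirror image of `D`. -/
def mirror {x y : List α} (D : P.Diagram x y) : P.Diagram y x :=
  Quot.lift (fun L => Quot.mk _ ⟨(L.1.map DerivStep.inv).reverse, L.2.mirror⟩)
    (fun L M h => by
      refine (Quot.sound ?_).symm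
      exact h.mirror) D

theorem comp_assoc {x y z t : List α} (A : P.Diagram x y) (B : P.Diagram y z)
    (C : P.Diagram z t) : (A.comp B).comp C = A.comp (B.comp C) := by
  induction A using Quot.ind
  induction B using Quot.ind
  induction C using Quot.ind
  exact congrArg (Quot.mk _) (Subtype.ext (by simp))

theorem trivial_comp {x y : List α} (A : P.Diagram x y) : (trivial P x).comp A = A := by
  induction A using Quot.ind
  rfl

theorem comp_trivial {x y : List α} (A : P.Diagram x y) : A.comp (trivial P y) = A := by
  induction A using Quot.ind
  exact congrArg (Quot.mk _) (Subtype.ext (by simp))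

theorem comp_addTrivial {x y z : List α} (A : P.Diagram x y) (B : P.Diagram y z) (s : List α) :
    (A.comp B).addTrivial s = (A.addTrivial s).comp (B.addTrivial s) := by
  induction A using Quot.ind
  induction B using Quot.ind
  exact congrArg (Quot.mk _) (Subtype.ext (by simp))

theorem trivialAdd_comp {x y z : List α} (A : P.Diagram x y) (B : P.Diagram y z) (s : List α) :
    trivialAdd s (A.comp B) = (trivialAdd s A).comp (trivialAdd s B) := by
  induction A using Quot.ind
  induction B using Quot.ind
  exact congrArg (Quot.mk _) (Subtype.ext (by simp))

theorem mirror_addTrivial {x y : List α} (A : P.Diagram x y) (s : List α) :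
    (A.addTrivial s).mirror = A.mirror.addTrivial s := by
  induction A using Quot.ind
  exact congrArg (Quot.mk _) (Subtype.ext (by
    simp [Function.comp_def, DerivStep.inv, DerivStep.addRight]))

theorem mirror_trivialAdd {x y : List α} (A : P.Diagram x y) (s : List α) :
    (trivialAdd s A).mirror = trivialAdd s A.mirror := by
  induction A using Quot.ind
  exact congrArg (Quot.mk _) (Subtype.ext (by
    simp [Function.comp_def, DerivStep.inv, DerivStep.addLeft]))

theorem mirror_comp {x y z : List α} (A : P.Diagram x y) (B : P.Diagram y z) :
    (A.comp B).mirror = B.mirror.comp A.mirror := by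
  induction A using Quot.ind
  induction B using Quot.ind
  exact congrArg (Quot.mk _) (Subtype.ext (by simp))

theorem mirror_mirror {x y : List α} (A : P.Diagram x y) : A.mirror.mirror = A := by
  induction A using Quot.ind
  exact congrArg (Quot.mk _) (Subtype.ext (by simp [Function.comp_def, DerivStep.inv]))

theorem numCells_mirror {x y : List α} (A : P.Diagram x y) : A.mirror.numCells = A.numCells := by
  induction A using Quot.ind
  simp [mirror, numCells]

theorem numCells_addTrivial {x y : List α} (A : P.Diagram x y) (s : List α) :
    (A.addTrivial s).numCells = A.numCells := by
  induction A using Quot.ind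
  simp [addTrivial, numCells, Quot.map]

theorem numCells_trivialAdd {x y : List α} (A : P.Diagram x y) (s : List α) :
    (trivialAdd s A).numCells = A.numCells := by
  induction A using Quot.ind
  simp [trivialAdd, numCells, Quot.map]

/-- An atomic diagram has distinct top and bottom labels. -/
theorem ne_of_numCells_eq_one {x y : List α} (A : P.Diagram x y) (h : A.numCells = 1) :
    x ≠ y := by
  induction A using Quot.ind with
  | mk L =>
    obtain ⟨L, hL⟩ := L
    obtain ⟨e, rfl⟩ := List.length_eq_one_iff.1 h
    obtain ⟨h1, rfl, h3⟩ := hL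
    rintro rfl
    simp only [IsDerivation, List.append_assoc, List.append_cancel_left_eq,
      List.append_cancel_right_eq] at h3
    exact h1.ne h3.symm

/-- Sums satisfy the interchange law. -/
theorem addTrivial_comp_trivialAdd {x y x' y' : List α} (A : P.Diagram x y)
    (B : P.Diagram x' y') :
    (A.addTrivial x').comp (trivialAdd y B) = (trivialAdd x B).comp (A.addTrivial y') := by
  induction A using Quot.ind with
  | mk L =>
  induction B using Quot.ind with
  | mk M =>
  obtain ⟨L, hL⟩ := L
  obtain ⟨M, hM⟩ := M
  suffices H : ∀ (M : List (DerivStep α)) (x' : List α) (hM : P.IsDerivation x' M y')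
      (y : List α) (L : List (DerivStep α)) (x : List α) (hL : P.IsDerivation x L y),
      comp (addTrivial (Quot.mk _ ⟨L, hL⟩ : P.Diagram x y) x')
        (trivialAdd y (Quot.mk _ ⟨M, hM⟩ : P.Diagram x' y')) =
      comp (trivialAdd x (Quot.mk _ ⟨M, hM⟩ : P.Diagram x' y'))
        (addTrivial (Quot.mk _ ⟨L, hL⟩ : P.Diagram x y) y') from H M x' hM y L x hL
  clear hL hM L M x x' y
  intro M
  induction M with
  | nil =>
    intro x' hM y L x hL
    cases hM
    exact congrArg (Quot.mk _) (Subtype.ext (by simp))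
  | cons f M ihM =>
    intro x' hM y L
    have hM' := hM
    obtain ⟨f1, rfl, f3⟩ := hM'
    induction L with
    | nil =>
      intro x hL
      cases hL
      exact congrArg (Quot.mk _) (Subtype.ext (by simp))
    | cons e L ihL =>
      intro x hL
      have hL' := hL
      obtain ⟨e1, rfl, e3⟩ := hL'
      let E : P.Diagram (e.left ++ e.top ++ e.right) (e.left ++ e.bot ++ e.right) := Quot.mk _ ⟨[e], e1, rfl, rfl⟩
      let F : P.Diagram (f.left ++ f.top ++ f.right) (f.left ++ f.bot ++ f.right) := Quot.mk _ ⟨[f], f1, rfl, rfl⟩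
      let A : P.Diagram (e.left ++ e.bot ++ e.right) y := Quot.mk _ ⟨L, e3⟩
      let B : P.Diagram (f.left ++ f.bot ++ f.right) y' := Quot.mk _ ⟨M, f3⟩
      have hA : (Quot.mk _ ⟨e :: L, hL⟩ : P.Diagram (e.left ++ e.top ++ e.right) y) =
          E.comp A := rfl
      have hB : (Quot.mk _ ⟨f :: M, hM⟩ : P.Diagram (f.left ++ f.top ++ f.right) y') =
          F.comp B := rfl
      have hEF : (E.addTrivial _).comp (trivialAdd _ F) =
          (trivialAdd _ F).comp (E.addTrivial _) := by
        apply Quot.sound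
        have := Exchange.mk [] [] e.left e.top e.bot (e.right ++ f.left) f.top f.bot f.right
        simpa [DerivStep.addRight, DerivStep.addLeft] using this
      have i1 : (A.addTrivial _).comp (trivialAdd y (F.comp B)) =
          (trivialAdd (e.left ++ e.bot ++ e.right) (F.comp B)).comp (A.addTrivial y') := ihL (e.left ++ e.bot ++ e.right) e3
      have i2 : (E.addTrivial (f.left ++ f.bot ++ f.right)).comp (trivialAdd (e.left ++ e.bot ++ e.right) B) =
          (trivialAdd _ B).comp (E.addTrivial y') := ihM (f.left ++ f.bot ++ f.right) f3 _ [e] _ ⟨e1, rfl, rfl⟩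
      rw [hA, hB, comp_addTrivial, comp_assoc, i1, trivialAdd_comp, comp_assoc, ← comp_assoc _ _
        (comp _ _), hEF, comp_assoc, ← comp_assoc (E.addTrivial (f.left ++ f.bot ++ f.right)), i2, trivialAdd_comp,
        comp_addTrivial]
      simp only [comp_assoc]

theorem sum_comp_sum {x y z x' y' z' : List α} (A : P.Diagram x y) (B : P.Diagram y z)
    (A' : P.Diagram x' y') (B' : P.Diagram y' z') :
    (A.sum A').comp (B.sum B') = (A.comp B).sum (A'.comp B') := by
  unfold sum
  rw [comp_addTrivial, trivialAdd_comp, comp_assoc, comp_assoc, ← comp_assoc (trivialAdd y A'),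
    ← addTrivial_comp_trivialAdd, comp_assoc]

/-- `D` is a prefix of `E`. -/
def IsPrefix {x y z : List α} (D : P.Diagram x y) (E : P.Diagram x z) : Prop :=
  ∃ F : P.Diagram y z, E = D.comp F

/-- `F` is a suffix of `E`. -/
def IsSuffix {x y z : List α} (F : P.Diagram y z) (E : P.Diagram x z) : Prop :=
  ∃ D : P.Diagram x y, E = D.comp F

/-- Thin diagrams: sums of atomic diagrams (an atomic diagram has exactly one cell).  A trivial
diagram counts as a thin diagram without cells. -/
inductive IsThin : ∀ {x y : List α}, P.Diagram x y → Prop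
  | trivial (x : List α) : IsThin (Diagram.trivial P x)
  | atomic {x y : List α} (A : P.Diagram x y) : A.numCells = 1 → IsThin A
  | sum {x y x' y' : List α} (A : P.Diagram x y) (B : P.Diagram x' y') :
      IsThin A → IsThin B → IsThin (A.sum B)

/-- `F` is the maximal thin suffix of `D`. -/
def IsMaximalThinSuffix {x y z : List α} (F : P.Diagram y z) (D : P.Diagram x z) : Prop :=
  F.IsThin ∧ F.IsSuffix D ∧
    ∀ (y' : List α) (F' : P.Diagram y' z), F'.IsThin → F'.IsSuffix D → F'.IsSuffix F

/-- A diagram is minimal if its maximal thin suffix has exactly one cell. -/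
def IsMinimal {x z : List α} (D : P.Diagram x z) : Prop :=
  ∃ (y : List α) (F : P.Diagram y z), F.IsMaximalThinSuffix D ∧ F.numCells = 1

/-- `E` is obtained from `D` by reducing a dipole, i.e. by removing a cell and a mirror image of
it that lies just below. -/
def ReducesDipole {x y : List α} (D E : P.Diagram x y) : Prop :=
  ∃ (z t : List α) (D₁ : P.Diagram x z) (A : P.Diagram z t) (D₂ : P.Diagram z y),
    A.numCells = 1 ∧ D = (D₁.comp (A.comp A.mirror)).comp D₂ ∧ E = D₁.comp D₂

/-- A diagram is reduced if it has no dipoles. -/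
def IsReduced {x y : List α} (D : P.Diagram x y) : Prop :=
  ¬ ∃ E : P.Diagram x y, D.ReducesDipole E

end Diagram

/-- `(x, y)`-diagrams modulo reduction of dipoles.  Every class holds exactly one reduced diagram,
so the classes stand for the reduced `(x, y)`-diagrams, and the product of classes induced by
concatenation is the reduced form of the concatenation. -/
def DiagramClass (x y : List α) : Type _ :=
  Quot fun D E : P.Diagram x y => D.ReducesDipole E

variable {P}

/-- The class of a diagram modulo reduction of dipoles. -/
def Diagram.toClass {x y : List α} (D : P.Diagram x y) : P.DiagramClass x y := Quot.mk _ D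

namespace DiagramClass

open Diagram

/-- The product of reduced diagrams: the reduced form of the concatenation. -/
def comp {x y z : List α} (g : P.DiagramClass x y) (h : P.DiagramClass y z) :
    P.DiagramClass x z :=
  Quot.map₂ Diagram.comp
    (by
      rintro D _ _ ⟨z, t, D₁, A, D₂, hA, rfl, rfl⟩
      exact ⟨z, t, D.comp D₁, A, D₂, hA, by simp only [comp_assoc], by simp only [comp_assoc]⟩)
    (by
      rintro _ _ D ⟨z, t, D₁, A, D₂, hA, rfl, rfl⟩
      exact ⟨z, t, D₁, A, D₂.comp D, hA, by simp only [comp_assoc], by simp only [comp_assoc]⟩)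
    g h

/-- The inverse, given by the mirror image. -/
def inv {x y : List α} (g : P.DiagramClass x y) : P.DiagramClass y x :=
  Quot.map Diagram.mirror
    (by
      rintro _ _ ⟨z, t, D₁, A, D₂, hA, rfl, rfl⟩
      exact ⟨z, t, D₂.mirror, A, D₁.mirror, hA,
        by simp only [mirror_comp, mirror_mirror, comp_assoc], by simp only [mirror_comp]⟩) g

/-- The sum of diagrams, modulo reduction of dipoles. -/
def sum {x y x' y' : List α} (g : P.DiagramClass x y) (h : P.DiagramClass x' y') :
    P.DiagramClass (x ++ x') (y ++ y') :=
  Quot.map₂ Diagram.sum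
    (by
      rintro D _ _ ⟨z, t, D₁, A, D₂, hA, rfl, rfl⟩
      refine ⟨_, _, (D.addTrivial _).comp (trivialAdd y D₁), trivialAdd y A, trivialAdd y D₂,
        by rw [numCells_trivialAdd, hA], ?_, ?_⟩ <;>
      simp only [Diagram.sum, trivialAdd_comp, mirror_trivialAdd, comp_assoc])
    (by
      rintro _ _ D ⟨z, t, D₁, A, D₂, hA, rfl, rfl⟩
      refine ⟨_, _, D₁.addTrivial _, A.addTrivial _, (D₂.addTrivial _).comp (trivialAdd _ D),
        by rw [numCells_addTrivial, hA], ?_, ?_⟩ <;>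
      simp only [Diagram.sum, comp_addTrivial, mirror_addTrivial, comp_assoc])
    g h

theorem comp_assoc {x y z t : List α} (g : P.DiagramClass x y) (h : P.DiagramClass y z)
    (k : P.DiagramClass z t) : (g.comp h).comp k = g.comp (h.comp k) := by
  induction g using Quot.ind
  induction h using Quot.ind
  induction k using Quot.ind
  exact congrArg (Quot.mk _) (Diagram.comp_assoc _ _ _)

theorem trivial_comp {x y : List α} (g : P.DiagramClass x y) :
    (trivial P x).toClass.comp g = g := by
  induction g using Quot.ind
  exact congrArg (Quot.mk _) (Diagram.trivial_comp _)

theorem comp_trivial {x y : List α} (g : P.DiagramClass x y) :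
    g.comp (trivial P y).toClass = g := by
  induction g using Quot.ind
  exact congrArg (Quot.mk _) (Diagram.comp_trivial _)

theorem inv_inv {x y : List α} (g : P.DiagramClass x y) : g.inv.inv = g := by
  induction g using Quot.ind
  exact congrArg (Quot.mk _) (Diagram.mirror_mirror _)

theorem comp_inv {x y : List α} (g : P.DiagramClass x y) :
    g.comp g.inv = (trivial P x).toClass := by
  induction g using Quot.ind with
  | mk D =>
  induction D using Quot.ind with
  | mk L =>
  obtain ⟨L, hL⟩ := L
  induction L generalizing x with
  | nil => cases hL; rfl
  | cons e L ih =>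
    have hL' := hL
    obtain ⟨e1, rfl, e3⟩ := hL'
    let E : P.Diagram (e.left ++ e.top ++ e.right) (e.left ++ e.bot ++ e.right) :=
      Quot.mk _ ⟨[e], e1, rfl, rfl⟩
    let A : P.Diagram (e.left ++ e.bot ++ e.right) y := Quot.mk _ ⟨L, e3⟩
    have hE : E.toClass.comp E.toClass.inv = (trivial P _).toClass := by
      apply Quot.sound
      refine ⟨_, _, trivial P _, E, trivial P _, rfl, ?_, ?_⟩
      · rw [Diagram.trivial_comp, Diagram.comp_trivial]
      · rw [Diagram.trivial_comp]
    have h1 : (Quot.mk _ (Quot.mk _ ⟨e :: L, hL⟩) : P.DiagramClass _ y) =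
        E.toClass.comp A.toClass := rfl
    have h2 : (E.toClass.comp A.toClass).inv = A.toClass.inv.comp E.toClass.inv :=
      congrArg (Quot.mk _) (mirror_comp E A)
    have hA : A.toClass.comp A.toClass.inv = (trivial P _).toClass := ih e3
    rw [h1, h2, comp_assoc, ← comp_assoc A.toClass, hA, trivial_comp, hE]

theorem inv_comp {x y : List α} (g : P.DiagramClass x y) :
    g.inv.comp g = (trivial P y).toClass := by
  have := comp_inv g.inv
  rwa [inv_inv] at this

theorem sum_comp_sum {x y z x' y' z' : List α} (g : P.DiagramClass x y) (h : P.DiagramClass y z)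
    (g' : P.DiagramClass x' y') (h' : P.DiagramClass y' z') :
    (g.sum g').comp (h.sum h') = (g.comp h).sum (g'.comp h') := by
  induction g using Quot.ind
  induction h using Quot.ind
  induction g' using Quot.ind
  induction h' using Quot.ind
  exact congrArg (Quot.mk _) (Diagram.sum_comp_sum _ _ _ _)

end DiagramClass

variable (P)

/-- The diagram group `D(P, w)`: `(w, w)`-diagrams modulo reduction of dipoles. -/
abbrev DiagramGroup (w : List α) : Type _ := P.DiagramClass w w

instance DiagramGroup.instGroup (w : List α) : Group (P.DiagramGroup w) where
  mul g h := DiagramClass.comp g h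
  one := (Diagram.trivial P w).toClass
  inv g := DiagramClass.inv g
  mul_assoc := DiagramClass.comp_assoc
  one_mul := DiagramClass.trivial_comp
  mul_one := DiagramClass.comp_trivial
  inv_mul_cancel := DiagramClass.inv_comp

/-- The homomorphism `D(P, a) × D(P, b) → D(P, aub)`, `(A, B) ↦ A + ε(u) + B`. -/
def canonicalHom (a u b : List α) :
    P.DiagramGroup a × P.DiagramGroup b →* P.DiagramGroup (a ++ u ++ b) where
  toFun g := DiagramClass.sum (DiagramClass.sum g.1 (Diagram.trivial P u).toClass) g.2
  map_one' := rfl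
  map_mul' g h := by
    change DiagramClass.sum (DiagramClass.sum (DiagramClass.comp g.1 h.1) _)
      (DiagramClass.comp g.2 h.2) = DiagramClass.comp _ _
    rw [DiagramClass.sum_comp_sum, DiagramClass.sum_comp_sum, DiagramClass.trivial_comp]

variable {P}

/-- The homomorphism `D(P, z) → D(P, w)`, `g ↦ D · g · D⁻¹`, for a `(w, z)`-diagram `D`. -/
def conjHom {w z : List α} (D : P.Diagram w z) : P.DiagramGroup z →* P.DiagramGroup w where
  toFun g := DiagramClass.comp (DiagramClass.comp D.toClass g) D.toClass.inv
  map_one' := by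
    change DiagramClass.comp (DiagramClass.comp _ (Diagram.trivial P z).toClass) _ =
      (Diagram.trivial P w).toClass
    rw [DiagramClass.comp_trivial, DiagramClass.comp_inv]
  map_mul' g h := by
    change DiagramClass.comp (DiagramClass.comp _ (DiagramClass.comp g h)) _ =
      DiagramClass.comp (DiagramClass.comp (DiagramClass.comp _ g) _)
        (DiagramClass.comp (DiagramClass.comp _ h) _)
    simp only [DiagramClass.comp_assoc]
    rw [← DiagramClass.comp_assoc D.toClass.inv, DiagramClass.inv_comp, DiagramClass.trivial_comp]

variable (P)

/-- The vertices of the Farley complex `X(P, w)`: reduced diagrams with top label `w` (as classes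
modulo reduction of dipoles); the first component is the bottom label. -/
def FarleyVertex (w : List α) : Type _ := Σ y : List α, P.DiagramClass w y

variable {P}

/-- The vertex given by the reduced form of `D`. -/
def Diagram.toVertex {w y : List α} (D : P.Diagram w y) : P.FarleyVertex w := ⟨y, D.toClass⟩

/-- The action of the diagram group on the vertices by left multiplication. -/
instance FarleyVertex.instMulAction (w : List α) :
    MulAction (P.DiagramGroup w) (P.FarleyVertex w) where
  smul g V := ⟨V.1, DiagramClass.comp g V.2⟩
  one_smul V := Sigma.ext rfl (heq_of_eq (DiagramClass.trivial_comp V.2))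
  mul_smul g h V := Sigma.ext rfl (heq_of_eq (DiagramClass.comp_assoc g h V.2))

variable (P)

/-- The 1-skeleton of the Farley complex: `V` and `W` span an edge if `W = V · A` for some atomic
diagram `A`. -/
def farleyGraph (w : List α) : SimpleGraph (P.FarleyVertex w) where
  Adj V W := ∃ A : P.Diagram V.1 W.1, A.numCells = 1 ∧ W.2 = V.2.comp A.toClass
  symm := ⟨by
    rintro V W ⟨A, hA, h⟩
    refine ⟨A.mirror, by rw [Diagram.numCells_mirror, hA], ?_⟩
    have : A.mirror.toClass = A.toClass.inv := rfl
    rw [h, this, DiagramClass.comp_assoc, DiagramClass.comp_inv, DiagramClass.comp_trivial]⟩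
  loopless := ⟨by
    rintro V ⟨A, hA, -⟩
    exact A.ne_of_numCells_eq_one hA rfl⟩

variable {P}

/-- `e` and `f` are parallel sides of a square of the Farley complex.  The squares are spanned by
`{V · Q | Q ≤ Γ}` with `Γ` thin with two cells; so `Γ = A + B` for atomic diagrams `A` and `B`, the
vertices are `V`, `V · (A + ε)`, `V · (ε + B)` and `V · (A + B)`, and the two pairs of opposite
sides are those listed. -/
inductive Parallel (w : List α) : Sym2 (P.FarleyVertex w) → Sym2 (P.FarleyVertex w) → Prop
  | left {x y x' y' : List α} (V : P.DiagramClass w (x ++ x')) (A : P.Diagram x y)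
      (B : P.Diagram x' y') (hA : A.numCells = 1) (hB : B.numCells = 1) :
      Parallel w
        s((⟨_, V⟩ : P.FarleyVertex w), ⟨_, V.comp (A.sum (.trivial P x')).toClass⟩)
        s((⟨_, V.comp ((Diagram.trivial P x).sum B).toClass⟩ : P.FarleyVertex w),
          ⟨_, V.comp (A.sum B).toClass⟩)
  | right {x y x' y' : List α} (V : P.DiagramClass w (x ++ x')) (A : P.Diagram x y)
      (B : P.Diagram x' y') (hA : A.numCells = 1) (hB : B.numCells = 1) :
      Parallel w
        s((⟨_, V⟩ : P.FarleyVertex w), ⟨_, V.comp ((Diagram.trivial P x).sum B).toClass⟩)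
        s((⟨_, V.comp (A.sum (.trivial P x')).toClass⟩ : P.FarleyVertex w),
          ⟨_, V.comp (A.sum B).toClass⟩)

/-- A hyperplane of the Farley complex: a class of edges for the equivalence relation generated by
being parallel sides of a square. -/
def IsHyperplane {w : List α} (J : Set (Sym2 (P.FarleyVertex w))) : Prop :=
  ∃ e ∈ (P.farleyGraph w).edgeSet, J = {f | Relation.EqvGen (Parallel w) e f}

/-- `H` is (the vertex set of) a halfspace of `J`: a connected component of the complex after
cutting along `J`. -/
def IsHalfspace {w : List α} (J : Set (Sym2 (P.FarleyVertex w))) (H : Set (P.FarleyVertex w)) :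
    Prop :=
  ∃ C : ((P.farleyGraph w).deleteEdges J).ConnectedComponent, H = C.supp

/-- `H` is the halfspace `J⁺` of `J` that does not contain `ε(w)`. -/
def IsPositiveHalfspace {w : List α} (J : Set (Sym2 (P.FarleyVertex w)))
    (H : Set (P.FarleyVertex w)) : Prop :=
  IsHalfspace J H ∧ (Diagram.trivial P w).toVertex ∉ H

/-- The vertices `E` of the Farley complex with `D ≤ E`, as reduced diagrams. -/
def Diagram.upperSet {w z : List α} (D : P.Diagram w z) : Set (P.FarleyVertex w) :=
  {V | ∃ E : P.Diagram w V.1, E.IsReduced ∧ E.toClass = V.2 ∧ D.IsPrefix E}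

/-- `D` is the minimal diagram associated with `J`: the minimal reduced diagram with
`J⁺ = {E | D ≤ E}`. -/
def IsMinimalDiagramOf {w z : List α} (J : Set (Sym2 (P.FarleyVertex w))) (D : P.Diagram w z) :
    Prop :=
  D.IsReduced ∧ D.IsMinimal ∧ IsPositiveHalfspace J D.upperSet

/-- The stabilizer of a set of edges in the diagram group. -/
def hyperplaneStabilizer {w : List α} (J : Set (Sym2 (P.FarleyVertex w))) :
    Subgroup (P.DiagramGroup w) where
  carrier := {g | Sym2.map (fun V => g • V) '' J = J}
  one_mem' := by simp
  mul_mem' := by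
    intro g h hg hh
    have : Sym2.map (fun V : P.FarleyVertex w => (g * h) • V) =
        Sym2.map (fun V => g • V) ∘ Sym2.map (fun V => h • V) := by
      rw [← Sym2.map_comp]
      simp [Function.comp_def, mul_smul]
    simp only [Set.mem_ofPred_eq] at *
    rw [this, Set.image_comp, hh, hg]
  inv_mem' := by
    intro g hg
    simp only [Set.mem_ofPred_eq] at *
    conv_lhs => rw [← hg]
    rw [← Set.image_comp, ← Sym2.map_comp]
    simp

end SemigroupPresentation

/-!
Track every letter of a word together with the cells above it. Derivations act on tracked words,
where a cell undoes the cell above it when the two form a dipole. The tracked bottom word of a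
diagram is therefore invariant under isotopy and under reduction of dipoles, and it determines a
reduced diagram, so that every diagram has a unique reduced form. The tracked bottom word of a sum
is the concatenation of those of the summands, hence `(A, B) ↦ A + ε(u) + B` is injective.

The edges parallel to `[D, D · (ε(a) + Π + ε(b))]` are the edges
`[D · (A + ε(u) + B), D · (A + Π + B)]`, where `A` and `B` are arbitrary diagrams with top labels
`a` and `b`. An edge determines the position of its cell, so `g` maps the first edge to one of
these if and only if `g · D = D · (A + ε(u) + B)` with `A ∈ D(P, a)` and `B ∈ D(P, b)`.
-/

/-! ### Derivations up to isotopy -/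

namespace DerivStep

variable {α : Type*}

/-- The word that `e` rewrites. -/
def source (e : DerivStep α) : List α := e.left ++ e.top ++ e.right

/-- The word that `e` produces. -/
def target (e : DerivStep α) : List α := e.left ++ e.bot ++ e.right

/-- Isotopy of derivations: the equivalence relation generated by exchanges. -/
def Isotopic (L M : List (DerivStep α)) : Prop := Relation.EqvGen Exchange L M

namespace Isotopic

variable {L M N : List (DerivStep α)}

@[refl] theorem refl (L : List (DerivStep α)) : Isotopic L L := Relation.EqvGen.refl L

@[symm] theorem symm (h : Isotopic L M) : Isotopic M L := Relation.EqvGen.symm _ _ h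

@[trans] theorem trans (h : Isotopic L M) (h' : Isotopic M N) : Isotopic L N :=
  Relation.EqvGen.trans _ _ _ h h'

theorem length (h : Isotopic L M) : L.length = M.length := by
  induction h with
  | rel _ _ h => exact h.length
  | refl => rfl
  | symm _ _ _ ih => exact ih.symm
  | trans _ _ _ _ _ ih ih' => exact ih.trans ih'

theorem append (h : Isotopic L M) (A B : List (DerivStep α)) :
    Isotopic (A ++ L ++ B) (A ++ M ++ B) := by
  induction h with
  | rel _ _ h => exact .rel _ _ (h.append A B)
  | refl => exact .refl _
  | symm _ _ _ ih => exact ih.symm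
  | trans _ _ _ _ _ ih ih' => exact ih.trans ih'

theorem eq_of_length_eq_one (h : Isotopic L M) (hL : L.length = 1) : L = M := by
  induction h with
  | rel _ _ h =>
    cases h
    simp only [List.length_append, List.length_cons] at hL
    omega
  | refl => rfl
  | symm _ _ h ih => exact (ih ((length h).trans hL)).symm
  | trans _ _ _ h _ ih ih' => exact (ih hL).trans (ih' ((length h).symm.trans hL))

end Isotopic

/-- No derivation isotopic to `L` has two consecutive mutually inverse steps. -/
def HasNoDipole (L : List (DerivStep α)) : Prop :=
  ∀ A e B, ¬ Isotopic L (A ++ e :: e.inv :: B)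

theorem HasNoDipole.of_append {L M : List (DerivStep α)} (h : HasNoDipole (L ++ M)) :
    HasNoDipole L := fun A e B hi => h A e (B ++ M) (by simpa using hi.append [] M)

theorem HasNoDipole.of_isotopic {L M : List (DerivStep α)} (h : HasNoDipole L)
    (hi : Isotopic L M) : HasNoDipole M := fun A e B hi' => h A e B (hi.trans hi')

/-- `s` and `t` rewrite disjoint subwords of one word; `s'` is what remains of `s` after `t`, and
`t'` is what remains of `t` after `s`. -/
inductive Independent : DerivStep α → DerivStep α → DerivStep α → DerivStep α → Prop
  | left (s t : DerivStep α) : Independent (s.addRight t.source) (t.addLeft s.source)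
      (s.addRight t.target) (t.addLeft s.target)
  | right (s t : DerivStep α) : Independent (t.addLeft s.source) (s.addRight t.source)
      (t.addLeft s.target) (s.addRight t.target)

namespace Independent

variable {s t s' t' : DerivStep α}

theorem symm (h : Independent s t s' t') : Independent t s t' s' := by
  cases h with
  | left s t => exact .right s t
  | right s t => exact .left s t

theorem inv_right (h : Independent s t s' t') : Independent s' t.inv s t'.inv := by
  cases h with
  | left s t => exact .left s t.inv
  | right s t => exact .right s.inv t

theorem exists_addRight_or_exists_addLeft {a u v b : List α}
    (h : Independent ⟨a, u, v, b⟩ t s' t') :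
    (∃ e : DerivStep α, a = e.source ∧ t = e.addRight (u ++ b) ∧ s' = ⟨e.target, u, v, b⟩) ∨
      ∃ e : DerivStep α, b = e.source ∧ t = e.addLeft (a ++ u) ∧ s' = ⟨a, u, v, e.target⟩ := by
  generalize hs : (⟨a, u, v, b⟩ : DerivStep α) = s at h
  cases h with
  | left s t =>
    cases hs
    exact .inr ⟨t.addLeft s.right, by simp [source, target, addLeft, addRight]⟩
  | right s t =>
    cases hs
    exact .inl ⟨s.addRight t.left, by simp [source, target, addLeft, addRight]⟩

theorem isotopic (h : Independent s t s' t') : Isotopic [s, t'] [t, s'] := by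
  have exchange (s t : DerivStep α) : Exchange [s.addRight t.source, t.addLeft s.target]
      [t.addLeft s.source, s.addRight t.target] := by
    simpa [source, target, addRight, addLeft] using
      Exchange.mk [] [] s.left s.top s.bot (s.right ++ t.left) t.top t.bot t.right
  cases h with
  | left s t => exact .rel _ _ (exchange s t)
  | right s t => exact .symm (.rel _ _ (exchange s t))

end Independent

theorem Exchange.exists_independent {L M : List (DerivStep α)} (h : Exchange L M) :
    ∃ A B s t s' t', Independent s t s' t' ∧ L = A ++ [s, t'] ++ B ∧ M = A ++ [t, s'] ++ B := by
  cases h with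
  | mk A B p u v q u' v' r =>
    refine ⟨A, B, _, _, _, _, .left ⟨p, u, v, q⟩ ⟨[], u', v', r⟩, ?_, ?_⟩ <;>
    simp [addRight, addLeft, source, target]

theorem Isotopic.append_independent {L M : List (DerivStep α)} {s t s' t' : DerivStep α}
    (h : Isotopic L (M ++ [t])) (hi : Independent s t s' t') :
    Isotopic (L ++ [s']) (M ++ [s] ++ [t']) := by
  have h₁ := h.append [] [s']
  have h₂ := hi.symm.isotopic.append M []
  simp only [List.nil_append, List.append_nil, List.append_assoc, List.cons_append] at h₁ h₂ ⊢
  exact h₁.trans h₂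

end DerivStep

/-! ### Tracked words -/

universe u

/-- Letters that remember the cells above them: `base s` is a letter of the initial word, and
`out M v j c` is the `j`-th letter `c` of the bottom label `v` of a cell glued below the tracked
word `M`. -/
inductive TrackedLetter (α : Type u) : Type u
  | base (s : α) : TrackedLetter α
  | out (M : List (TrackedLetter α)) (v : List α) (j : ℕ) (c : α) : TrackedLetter α

namespace TrackedLetter

open DerivStep

variable {α : Type u} {T T' T₁ T₂ : List (TrackedLetter α)} {u v v' : List α} {e f : DerivStep α}

/-- The letter without its history. -/
def label : TrackedLetter α → α
  | base s => s
  | out _ _ _ c => c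

@[simp] theorem map_label_map_base (x : List α) : (x.map base).map label = x := by
  simp [Function.comp_def, label]

theorem exists_eq_append_of_map_label_eq {p q : List α} (h : T.map label = p ++ u ++ q) :
    ∃ A B C, T = A ++ B ++ C ∧ A.map label = p ∧ B.map label = u ∧ C.map label = q := by
  obtain ⟨S, C, rfl, hS, hC⟩ := List.map_eq_append_iff.1 h
  obtain ⟨A, B, rfl, hA, hB⟩ := List.map_eq_append_iff.1 hS
  exact ⟨A, B, C, rfl, hA, hB, hC⟩

/-- The tracked bottom word of a cell with bottom label `v` glued below `M`. -/
def cellBottom (M : List (TrackedLetter α)) (v : List α) : List (TrackedLetter α) :=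
  v.mapIdx fun j c => out M v j c

@[simp] theorem length_cellBottom (M : List (TrackedLetter α)) (v : List α) :
    (cellBottom M v).length = v.length := by simp [cellBottom]

@[simp] theorem map_label_cellBottom (M : List (TrackedLetter α)) (v : List α) :
    (cellBottom M v).map label = v := by
  apply List.ext_getElem <;> simp [cellBottom, label]

theorem mem_cellBottom {M : List (TrackedLetter α)} {t : TrackedLetter α}
    (h : t ∈ cellBottom M v) : ∃ j c, t = out M v j c := by
  obtain ⟨j, hj, rfl⟩ := List.mem_mapIdx.1 h
  exact ⟨_, _, rfl⟩

theorem exists_mem_cellBottom (M : List (TrackedLetter α)) (hv : v ≠ []) :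
    ∃ j c, out M v j c ∈ cellBottom M v := by
  obtain ⟨c, v, rfl⟩ := List.exists_cons_of_ne_nil hv
  exact ⟨0, c, by simp [cellBottom]⟩

theorem getElem?_cellBottom {M : List (TrackedLetter α)} {i : ℕ} (h : i < v.length) :
    (cellBottom M v)[i]? = some (out M v i v[i]) := by
  simp [cellBottom, h]

theorem eq_of_cellBottom_eq {M N : List (TrackedLetter α)} (hv : v ≠ [])
    (h : cellBottom M v = cellBottom N v') : M = N := by
  obtain ⟨j, c, hc⟩ := exists_mem_cellBottom M hv
  obtain ⟨j', c', h'⟩ := mem_cellBottom (h ▸ hc)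
  cases h'
  rfl

theorem cellBottom_overlap_of_length_le {A B C A' B' C' : List (TrackedLetter α)} (hv' : v' ≠ [])
    (h : A ++ cellBottom B v ++ C = A' ++ cellBottom B' v' ++ C') (hle : A.length ≤ A'.length) :
    (A = A' ∧ B = B' ∧ v = v' ∧ C = C') ∨
      ∃ K, A' = A ++ cellBottom B v ++ K ∧ C = K ++ cellBottom B' v' ++ C' := by
  simp only [List.append_assoc] at h ⊢
  obtain ⟨X, rfl⟩ : A <+: A' :=
    List.prefix_of_prefix_length_le ⟨_, h⟩ ⟨_, rfl⟩ hle
  rw [List.append_assoc, List.append_cancel_left_eq] at h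
  rcases le_or_gt v.length X.length with hX | hX
  · obtain ⟨K, rfl⟩ : cellBottom B v <+: X :=
      List.prefix_of_prefix_length_le ⟨_, h⟩ ⟨_, rfl⟩ (by simpa using hX)
    rw [List.append_assoc, List.append_cancel_left_eq] at h
    exact .inr ⟨K, rfl, h⟩
  · -- The first letter below `B'` is also the letter number `X.length` below `B`.
    have hletter := congrArg (fun l => l[X.length]?) h
    have hpos := List.length_pos_of_ne_nil hv'
    rw [List.getElem?_append_left (by simpa using hX), List.getElem?_append_right le_rfl,
      List.getElem?_append_left (by simpa using hpos), getElem?_cellBottom hX, Nat.sub_self,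
      getElem?_cellBottom hpos, Option.some.injEq, out.injEq] at hletter
    obtain ⟨rfl, rfl, hX₀, -⟩ := hletter
    obtain rfl := List.length_eq_zero_iff.1 hX₀
    exact .inl ⟨by simp, rfl, rfl, List.append_cancel_left h⟩

/-- `T` is the whole bottom word of a cell whose mirror image has bottom label `v`, so that gluing
this mirror image below `T` gives a dipole. -/
def Cancels (v : List α) (T : List (TrackedLetter α)) : Prop :=
  ∃ M, M.map label = v ∧ T = cellBottom M (T.map label)

open Classical in
/-- Gluing a cell with bottom label `v` below the tracked word `T`; a dipole is removed. -/
noncomputable def attachCell (v : List α) (T : List (TrackedLetter α)) : List (TrackedLetter α) :=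
  if h : Cancels v T then h.choose else cellBottom T v

theorem attachCell_of_not_cancels (h : ¬ Cancels v T) : attachCell v T = cellBottom T v :=
  dif_neg h

theorem attachCell_cellBottom (hu : u ≠ []) (M : List (TrackedLetter α)) :
    attachCell (M.map label) (cellBottom M u) = M := by
  have h : Cancels (M.map label) (cellBottom M u) := ⟨M, rfl, by simp⟩
  rw [attachCell, dif_pos h]
  exact (eq_of_cellBottom_eq hu h.choose_spec.2).symm

@[simp] theorem map_label_attachCell (v : List α) (T : List (TrackedLetter α)) :
    (attachCell v T).map label = v := by
  unfold attachCell
  split_ifs with h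
  · exact h.choose_spec.1
  · simp

/-- No two cells in the history of the letter form a dipole. -/
inductive HasReducedHistory : TrackedLetter α → Prop
  | base (s : α) : HasReducedHistory (base s)
  | out (M : List (TrackedLetter α)) (v : List α) (j : ℕ) (c : α)
      (hM : ∀ m ∈ M, HasReducedHistory m) (h : ¬ Cancels v M) : HasReducedHistory (out M v j c)

theorem hasReducedHistory_out {M : List (TrackedLetter α)} {j : ℕ} {c : α} :
    HasReducedHistory (out M v j c) ↔ (∀ m ∈ M, HasReducedHistory m) ∧ ¬ Cancels v M :=
  ⟨fun h => by cases h; exact ⟨‹_›, ‹_›⟩, fun h => .out M v j c h.1 h.2⟩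

theorem forall_mem_cellBottom_hasReducedHistory {M : List (TrackedLetter α)} (hv : v ≠ []) :
    (∀ t ∈ cellBottom M v, HasReducedHistory t) ↔
      (∀ m ∈ M, HasReducedHistory m) ∧ ¬ Cancels v M := by
  constructor
  · intro h
    obtain ⟨j, c, hj⟩ := exists_mem_cellBottom M hv
    exact hasReducedHistory_out.1 (h _ hj)
  · intro h t ht
    obtain ⟨j, c, rfl⟩ := mem_cellBottom ht
    exact hasReducedHistory_out.2 h

/-- The action of a derivation step on the tracked words with label `e.source`. -/
noncomputable def applyStep (T : List (TrackedLetter α)) (e : DerivStep α) :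
    List (TrackedLetter α) :=
  T.take e.left.length ++ attachCell e.bot ((T.drop e.left.length).take e.top.length) ++
    T.drop (e.left.length + e.top.length)

theorem applyStep_append {A B : List (TrackedLetter α)} (hA : A.map label = e.left)
    (hB : B.map label = e.top) (C : List (TrackedLetter α)) :
    applyStep (A ++ B ++ C) e = A ++ attachCell e.bot B ++ C := by
  simp [applyStep, ← hA, ← hB]

theorem map_label_applyStep (hT : T.map label = e.source) :
    (applyStep T e).map label = e.target := by
  obtain ⟨A, B, C, rfl, hA, hB, hC⟩ := exists_eq_append_of_map_label_eq hT
  rw [applyStep_append hA hB]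
  simp [hA, hC, target]

theorem applyStep_addRight (hT : T.map label = e.source) (S : List (TrackedLetter α))
    (z : List α) : applyStep (T ++ S) (e.addRight z) = applyStep T e ++ S := by
  obtain ⟨A, B, C, rfl, hA, hB, -⟩ := exists_eq_append_of_map_label_eq hT
  rw [List.append_assoc, applyStep_append hA hB, applyStep_append (e := e.addRight z) hA hB]
  simp [addRight]

theorem applyStep_addLeft (hT : T.map label = e.source) {S : List (TrackedLetter α)}
    {z : List α} (hS : S.map label = z) :
    applyStep (S ++ T) (e.addLeft z) = S ++ applyStep T e := by
  obtain ⟨A, B, C, rfl, hA, hB, -⟩ := exists_eq_append_of_map_label_eq hT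
  have hSA : (S ++ A).map label = (e.addLeft z).left := by simp [addLeft, hS, hA]
  rw [applyStep_append hA hB, ← List.append_assoc, ← List.append_assoc,
    applyStep_append (e := e.addLeft z) hSA hB]
  simp [addLeft]

theorem applyStep_applyStep_of_independent {s t s' t' : DerivStep α}
    (h : Independent s t s' t') (hT : T.map label = s.source) :
    applyStep (applyStep T s) t' = applyStep (applyStep T t) s' := by
  suffices key : ∀ s t : DerivStep α, T.map label = s.source ++ t.source →
      applyStep (applyStep T (s.addRight t.source)) (t.addLeft s.target) =
        applyStep (applyStep T (t.addLeft s.source)) (s.addRight t.target) by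
    cases h with
    | left s t => exact key s t (by simpa [source, addRight] using hT)
    | right s t => exact (key s t (by simpa [source, addLeft] using hT)).symm
  intro s t h
  obtain ⟨U, V, rfl, hU, hV⟩ := List.map_eq_append_iff.1 h
  rw [applyStep_addRight hU, applyStep_addLeft hV (map_label_applyStep hU),
    applyStep_addLeft hV hU, applyStep_addRight hU]

/-- `T'` arises from the tracked word `T` by gluing the cell of the step `e` below it, and this
does not give a dipole. -/
inductive IsExtension :
    List (TrackedLetter α) → DerivStep α → List (TrackedLetter α) → Prop
  | mk (A B C : List (TrackedLetter α)) (v : List α) (hv : v ≠ []) (h : ¬ Cancels v B) :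
      IsExtension (A ++ B ++ C) ⟨A.map label, B.map label, v, C.map label⟩
        (A ++ cellBottom B v ++ C)

theorem IsExtension.applyStep_eq (h : IsExtension T e T') : applyStep T e = T' := by
  cases h with
  | mk A B C v _ h =>
    rw [applyStep_append (e := ⟨_, _, _, _⟩) rfl rfl, attachCell_of_not_cancels h]

theorem IsExtension.applyStep_inv_eq (h : IsExtension T e T') : applyStep T' e.inv = T := by
  cases h with
  | mk A B C v hv _ =>
    rw [applyStep_append (e := inv ⟨_, _, _, _⟩) rfl (by simp [inv])]
    simp only [inv, attachCell_cellBottom hv]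

theorem IsExtension.forall_hasReducedHistory_iff (h : IsExtension T e T') :
    (∀ t ∈ T', HasReducedHistory t) ↔ ∀ t ∈ T, HasReducedHistory t := by
  cases h with
  | mk A B C v hv h =>
    simp only [List.forall_mem_append, forall_mem_cellBottom_hasReducedHistory hv, h,
      not_false_eq_true, and_true]

theorem not_isExtension_map_base (x : List α) : ¬ IsExtension T e (x.map base) := by
  intro h
  generalize hS : x.map base = S at h
  cases h with
  | mk A B C v hv _ =>
    obtain ⟨j, c, hj⟩ := exists_mem_cellBottom B hv
    have hmem : out B v j c ∈ x.map base := by simp [hS, hj]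
    simp at hmem

theorem isExtension_or_isExtension_inv (hT : T.map label = e.source) (htop : e.top ≠ [])
    (hbot : e.bot ≠ []) (hred : ∀ t ∈ T, HasReducedHistory t) :
    IsExtension T e (applyStep T e) ∨ IsExtension (applyStep T e) e.inv T := by
  obtain ⟨p, u, v, q⟩ := e
  obtain ⟨A, B, C, rfl, rfl, rfl, rfl⟩ := exists_eq_append_of_map_label_eq hT
  rw [applyStep_append (e := ⟨_, _, _, _⟩) rfl rfl]
  by_cases h : Cancels v B
  · obtain ⟨M, rfl, hB⟩ := h
    have hBred : ∀ t ∈ cellBottom M (B.map label), HasReducedHistory t := fun t ht =>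
      hred t (by rw [← hB] at ht; simp [ht])
    have hext := IsExtension.mk A M C _ htop
      ((forall_mem_cellBottom_hasReducedHistory htop).1 hBred).2
    have hattach := attachCell_cellBottom htop M
    rw [← hB] at hext hattach
    rw [hattach]
    exact .inr hext
  · rw [attachCell_of_not_cancels h]
    exact .inl (.mk A B C v hbot h)

theorem applyStep_inv_applyStep (hT : T.map label = e.source) (htop : e.top ≠ [])
    (hbot : e.bot ≠ []) (hred : ∀ t ∈ T, HasReducedHistory t) :
    applyStep (applyStep T e) e.inv = T := by
  rcases isExtension_or_isExtension_inv hT htop hbot hred with h | h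
  · exact h.applyStep_inv_eq
  · exact h.applyStep_eq

theorem hasReducedHistory_applyStep (hT : T.map label = e.source) (htop : e.top ≠ [])
    (hbot : e.bot ≠ []) (hred : ∀ t ∈ T, HasReducedHistory t) :
    ∀ t ∈ applyStep T e, HasReducedHistory t := by
  rcases isExtension_or_isExtension_inv hT htop hbot hred with h | h
  · exact h.forall_hasReducedHistory_iff.2 hred
  · exact h.forall_hasReducedHistory_iff.1 hred

theorem IsExtension.diamond_of_length_le (he : IsExtension T₁ e T) (hf : IsExtension T₂ f T)
    (hle : e.left.length ≤ f.left.length) :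
    (T₁ = T₂ ∧ e = f) ∨ ∃ T₀ e₀ f₀,
      Independent e₀ f₀ e f ∧ IsExtension T₀ e₀ T₂ ∧ IsExtension T₀ f₀ T₁ := by
  generalize hS : T = S at hf
  cases he with
  | mk A B C v hv hB =>
  cases hf with
  | mk A' B' C' v' hv' hB' =>
  rcases cellBottom_overlap_of_length_le hv' hS (by simpa using hle) with
    ⟨rfl, rfl, rfl, rfl⟩ | ⟨K, rfl, rfl⟩
  · exact .inl ⟨rfl, rfl⟩
  · let s : DerivStep α := ⟨A.map label, B.map label, v, []⟩
    let t : DerivStep α := ⟨K.map label, B'.map label, v', C'.map label⟩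
    have hs := IsExtension.mk A B (K ++ B' ++ C') v hv hB
    have ht := IsExtension.mk (A ++ B ++ K) B' C' v' hv' hB'
    refine .inr ⟨A ++ B ++ K ++ B' ++ C', s.addRight t.source, t.addLeft s.source, ?_, ?_, ?_⟩
    · simpa [s, t, addRight, addLeft, source, target] using Independent.left s t
    · simpa [s, t, addRight, source] using hs
    · simpa [s, t, addLeft, source] using ht

theorem IsExtension.diamond (he : IsExtension T₁ e T) (hf : IsExtension T₂ f T) :
    (T₁ = T₂ ∧ e = f) ∨ ∃ T₀ e₀ f₀,
      Independent e₀ f₀ e f ∧ IsExtension T₀ e₀ T₂ ∧ IsExtension T₀ f₀ T₁ := by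
  rcases le_total e.left.length f.left.length with hle | hle
  · exact he.diamond_of_length_le hf hle
  · rcases hf.diamond_of_length_le he hle with ⟨rfl, rfl⟩ | ⟨T₀, f₀, e₀, hi, hf₀, he₀⟩
    · exact .inl ⟨rfl, rfl⟩
    · exact .inr ⟨T₀, e₀, f₀, hi.symm, he₀, hf₀⟩

/-- The action of a derivation on tracked words. -/
noncomputable def run (T : List (TrackedLetter α)) (L : List (DerivStep α)) :
    List (TrackedLetter α) := L.foldl applyStep T

@[simp] theorem run_nil (T : List (TrackedLetter α)) : run T [] = T := rfl

@[simp] theorem run_cons (T : List (TrackedLetter α)) (e : DerivStep α) (L : List (DerivStep α)) :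
    run T (e :: L) = run (applyStep T e) L := rfl

@[simp] theorem run_append (T : List (TrackedLetter α)) (L M : List (DerivStep α)) :
    run T (L ++ M) = run (run T L) M := List.foldl_append

end TrackedLetter

namespace SemigroupPresentation

open DerivStep TrackedLetter

variable {α : Type u} {P : SemigroupPresentation α} {x y z : List α} {e f : DerivStep α}
  {L M : List (DerivStep α)} {T : List (TrackedLetter α)}

theorem IsCell.ne_nil {u v : List α} (h : P.IsCell u v) : u ≠ [] ∧ v ≠ [] := by
  rcases h with h | h
  · exact P.ne_nil h
  · exact (P.ne_nil h).symm

theorem isDerivation_singleton :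
    P.IsDerivation x [e] y ↔ P.IsCell e.top e.bot ∧ x = e.source ∧ y = e.target := by
  simp [IsDerivation, source, target, eq_comm]

theorem isDerivation_append :
    P.IsDerivation x (L ++ M) z ↔ ∃ y, P.IsDerivation x L y ∧ P.IsDerivation y M z := by
  refine ⟨fun h => ?_, fun ⟨y, h, h'⟩ => h.append h'⟩
  induction L generalizing x with
  | nil => exact ⟨x, rfl, h⟩
  | cons e L ih =>
    obtain ⟨y, hL, hM⟩ := ih h.2.2
    exact ⟨y, ⟨h.1, h.2.1, hL⟩, hM⟩

theorem isDerivation_append_singleton :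
    P.IsDerivation x (L ++ [e]) z ↔
      P.IsDerivation x L e.source ∧ P.IsCell e.top e.bot ∧ z = e.target := by
  simp only [isDerivation_append, isDerivation_singleton]
  exact ⟨fun ⟨_, hL, he, hy, hz⟩ => ⟨hy ▸ hL, he, hz⟩, fun ⟨hL, he, hz⟩ => ⟨_, hL, he, rfl, hz⟩⟩

theorem IsDerivation.map_label_run (h : P.IsDerivation x L y) (hT : T.map label = x) :
    (run T L).map label = y := by
  induction L generalizing x T with
  | nil => exact hT.trans h
  | cons e L ih => exact ih h.2.2 (map_label_applyStep (hT.trans h.2.1))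

theorem IsDerivation.hasReducedHistory_run (h : P.IsDerivation x L y) (hT : T.map label = x)
    (hred : ∀ t ∈ T, HasReducedHistory t) : ∀ t ∈ run T L, HasReducedHistory t := by
  induction L generalizing x T with
  | nil => exact hred
  | cons e L ih =>
    obtain ⟨he, rfl, hL⟩ := h
    exact ih hL (map_label_applyStep hT)
      (hasReducedHistory_applyStep hT he.ne_nil.1 he.ne_nil.2 hred)

theorem IsDerivation.hasReducedHistory_run_map_base (h : P.IsDerivation x L y) :
    ∀ t ∈ run (x.map base) L, HasReducedHistory t :=
  h.hasReducedHistory_run (map_label_map_base x) (List.forall_mem_map.2 fun s _ => .base s)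

theorem IsDerivation.run_addRight (h : P.IsDerivation x L y) (hT : T.map label = x)
    (S : List (TrackedLetter α)) (z : List α) :
    run (T ++ S) (L.map (DerivStep.addRight z)) = run T L ++ S := by
  induction L generalizing x T with
  | nil => rfl
  | cons e L ih =>
    obtain ⟨-, rfl, hL⟩ := h
    simp only [List.map_cons, run_cons, applyStep_addRight hT, ih hL (map_label_applyStep hT)]

theorem IsDerivation.run_addLeft (h : P.IsDerivation x L y) (hT : T.map label = x)
    {S : List (TrackedLetter α)} {z : List α} (hS : S.map label = z) :
    run (S ++ T) (L.map (DerivStep.addLeft z)) = S ++ run T L := by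
  induction L generalizing x T with
  | nil => rfl
  | cons e L ih =>
    obtain ⟨-, rfl, hL⟩ := h
    simp only [List.map_cons, run_cons, applyStep_addLeft hT hS, ih hL (map_label_applyStep hT)]

theorem isDerivation_iff_of_isotopic (h : Isotopic L M) :
    P.IsDerivation x L y ↔ P.IsDerivation x M y := by
  induction h with
  | rel _ _ h =>
    cases h with
    | mk A B p u v q u' v' r =>
      simp only [isDerivation_append, IsDerivation, List.append_assoc, true_and]
      exact exists_congr fun z => and_congr_right fun _ => by tauto
  | refl => rfl
  | symm _ _ _ ih => exact ih.symm
  | trans _ _ _ _ _ ih ih' => exact ih.trans ih'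

theorem IsDerivation.run_eq_of_isotopic (hL : P.IsDerivation x L y) (h : Isotopic L M)
    (hT : T.map label = x) : run T L = run T M := by
  induction h with
  | rel _ _ h =>
    obtain ⟨A, B, s, t, s', t', hi, rfl, rfl⟩ := h.exists_independent
    obtain ⟨z, hA, hB⟩ := isDerivation_append.1 (List.append_assoc A _ B ▸ hL)
    have hTA := (hA.map_label_run hT).trans hB.2.1
    simp only [run_append, run_cons, run_nil, applyStep_applyStep_of_independent hi hTA]
  | refl => rfl
  | symm _ _ h ih => exact (ih ((isDerivation_iff_of_isotopic h).2 hL)).symm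
  | trans _ _ _ h _ ih ih' => exact (ih hL).trans (ih' ((isDerivation_iff_of_isotopic h).1 hL))

theorem IsDerivation.run_append_dipole (h : P.IsDerivation x (L ++ e :: e.inv :: M) y) :
    run (x.map base) (L ++ e :: e.inv :: M) = run (x.map base) (L ++ M) := by
  obtain ⟨z, hL, he, rfl, -⟩ := isDerivation_append.1 h
  simp only [run_append, run_cons, applyStep_inv_applyStep (hL.map_label_run (map_label_map_base x))
    he.ne_nil.1 he.ne_nil.2 hL.hasReducedHistory_run_map_base]

theorem IsDerivation.isExtension_run_of_forall_exists_isotopic (h : P.IsDerivation x (L ++ [f]) y)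
    (hd : HasNoDipole (L ++ [f]))
    (hlast : ∀ T e, IsExtension T e (run (x.map base) L) → ∃ L', Isotopic L (L' ++ [e])) :
    IsExtension (run (x.map base) L) f (run (x.map base) (L ++ [f])) := by
  obtain ⟨hL, hf, -⟩ := isDerivation_append_singleton.1 h
  rw [run_append]
  refine (isExtension_or_isExtension_inv (hL.map_label_run (map_label_map_base x)) hf.ne_nil.1
    hf.ne_nil.2 hL.hasReducedHistory_run_map_base).resolve_right fun hinv => ?_
  obtain ⟨L', hi⟩ := hlast _ _ hinv
  exact hd L' f.inv [] (by simpa [DerivStep.inv] using hi.append [] [f])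

theorem IsDerivation.exists_isotopic_append_singleton (h : P.IsDerivation x L y)
    (hd : HasNoDipole L) (hT : IsExtension T e (run (x.map base) L)) :
    ∃ L', Isotopic L (L' ++ [e]) ∧ run (x.map base) L' = T := by
  induction L using List.reverseRecOn generalizing y T e with
  | nil => exact absurd hT (not_isExtension_map_base x)
  | append_singleton L f ih =>
    have ih' {T e} := ih (T := T) (e := e) (isDerivation_append_singleton.1 h).1 hd.of_append
    have hf := h.isExtension_run_of_forall_exists_isotopic hd
      fun T e hT => (ih' hT).imp fun _ => And.left
    rcases hT.diamond hf with ⟨rfl, rfl⟩ | ⟨T₀, e₀, f₀, hi, he₀, hf₀⟩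
    · exact ⟨L, .refl _, rfl⟩
    · obtain ⟨L', hL', rfl⟩ := ih' he₀
      exact ⟨L' ++ [f₀], hL'.append_independent hi.symm, by simpa using hf₀.applyStep_eq⟩

theorem IsDerivation.isExtension_run_of_hasNoDipole (h : P.IsDerivation x (L ++ [f]) y)
    (hd : HasNoDipole (L ++ [f])) :
    IsExtension (run (x.map base) L) f (run (x.map base) (L ++ [f])) :=
  h.isExtension_run_of_forall_exists_isotopic hd fun _ _ hT =>
    ((isDerivation_append_singleton.1 h).1.exists_isotopic_append_singleton hd.of_append hT).imp
      fun _ => And.left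

theorem IsDerivation.isotopic_of_run_eq (hL : P.IsDerivation x L y) (hM : P.IsDerivation x M z)
    (hLd : HasNoDipole L) (hMd : HasNoDipole M) (h : run (x.map base) L = run (x.map base) M) :
    Isotopic L M := by
  induction L using List.reverseRecOn generalizing y z M with
  | nil =>
    induction M using List.reverseRecOn with
    | nil => rfl
    | append_singleton M f _ =>
      have hf := hM.isExtension_run_of_hasNoDipole hMd
      rw [← h] at hf
      exact absurd hf (not_isExtension_map_base x)
  | append_singleton L f ih =>
    have hf := hL.isExtension_run_of_hasNoDipole hLd
    rw [h] at hf
    obtain ⟨M', hi, hrun⟩ := hM.exists_isotopic_append_singleton hMd hf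
    have hM' := (isDerivation_append_singleton.1 ((isDerivation_iff_of_isotopic hi).1 hM)).1
    have hLM := ih (isDerivation_append_singleton.1 hL).1 hM' hLd.of_append
      (hMd.of_isotopic hi).of_append hrun.symm
    have hLMf := hLM.append [] [f]
    exact hLMf.trans hi.symm

/-! ### Reduced forms -/

variable {x' y' : List α}

namespace Diagram

variable {D E : P.Diagram x y}

/-- The diagram drawn by a derivation. -/
def ofDerivation (h : P.IsDerivation x L y) : P.Diagram x y := Quot.mk _ ⟨L, h⟩

theorem exists_ofDerivation (D : P.Diagram x y) :
    ∃ (L : List (DerivStep α)) (h : P.IsDerivation x L y), D = ofDerivation h := by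
  induction D using Quot.ind with
  | mk L => exact ⟨L.1, L.2, rfl⟩

theorem exists_ofDerivation_singleton (hD : D.numCells = 1) :
    ∃ (e : DerivStep α) (h : P.IsDerivation x [e] y), D = ofDerivation h := by
  obtain ⟨L, h, rfl⟩ := D.exists_ofDerivation
  obtain ⟨e, rfl⟩ := List.length_eq_one_iff.1 hD
  exact ⟨e, h, rfl⟩

theorem ofDerivation_congr (hL : P.IsDerivation x L y) (h : L = M) :
    ofDerivation hL = ofDerivation (h ▸ hL) := by
  subst h
  rfl

theorem ofDerivation_eq_iff (hL : P.IsDerivation x L y) (hM : P.IsDerivation x M y) :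
    ofDerivation hL = ofDerivation hM ↔ Isotopic L M := by
  refine ⟨fun h => Quot.eqvGen_exact (congrArg
    (Quot.map (rb := Exchange) Subtype.val fun _ _ h => h) h), fun h => ?_⟩
  induction h with
  | rel _ _ h => exact Quot.sound h
  | refl => rfl
  | symm _ _ _ ih => exact (ih hM hL).symm
  | trans _ _ _ h _ ih ih' =>
    have hmid := (isDerivation_iff_of_isotopic h).1 hL
    exact (ih hL hmid).trans (ih' hmid hM)

theorem numCells_comp (D : P.Diagram x y) (E : P.Diagram y z) :
    (D.comp E).numCells = D.numCells + E.numCells := by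
  induction D using Quot.ind
  induction E using Quot.ind
  exact List.length_append

theorem ReducesDipole.numCells_add_two (h : D.ReducesDipole E) :
    E.numCells + 2 = D.numCells := by
  obtain ⟨z, t, D₁, A, D₂, hA, rfl, rfl⟩ := h
  simp only [numCells_comp, numCells_mirror, hA]
  omega

theorem isReduced_of_numCells_eq_one (h : D.numCells = 1) : D.IsReduced := by
  rintro ⟨E, hE⟩
  have := hE.numCells_add_two
  omega

theorem IsReduced.of_comp {F : P.Diagram y z} (h : (D.comp F).IsReduced) : D.IsReduced := by
  rintro ⟨_, z, t, D₁, A, D₂, hA, rfl, rfl⟩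
  exact h ⟨D₁.comp (D₂.comp F), z, t, D₁, A, D₂.comp F, hA, by simp only [comp_assoc], rfl⟩

theorem exists_isReduced (D : P.Diagram x y) :
    ∃ E : P.Diagram x y, E.IsReduced ∧ E.toClass = D.toClass := by
  induction hn : D.numCells using Nat.strong_induction_on generalizing D with
  | _ n ih =>
    by_cases h : D.IsReduced
    · exact ⟨D, h, rfl⟩
    · obtain ⟨E, hE⟩ := not_not.1 h
      obtain ⟨R, hR, hRE⟩ := ih E.numCells (by have := hE.numCells_add_two; omega) E rfl
      exact ⟨R, hR, hRE.trans (Quot.sound hE).symm⟩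

theorem IsReduced.hasNoDipole {h : P.IsDerivation x L y} (hred : (ofDerivation h).IsReduced) :
    HasNoDipole L := by
  intro A e B hi
  have h' := (isDerivation_iff_of_isotopic hi).1 h
  obtain ⟨z, hA, he, rfl, -, -, hB⟩ := isDerivation_append.1 h'
  refine hred ⟨(ofDerivation hA).comp (ofDerivation hB), _, _, ofDerivation hA,
    ofDerivation (L := [e]) ⟨he, rfl, rfl⟩, ofDerivation hB, rfl, ?_, rfl⟩
  rw [(ofDerivation_eq_iff h h').2 hi]
  exact ofDerivation_congr h' (by simp)

/-- The tracked bottom word of a diagram. -/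
noncomputable def trace (D : P.Diagram x y) : List (TrackedLetter α) :=
  Quot.lift (fun L => run (x.map base) L.1)
    (fun L _ h => L.2.run_eq_of_isotopic (.rel _ _ h) (map_label_map_base x)) D

theorem map_label_trace (D : P.Diagram x y) : D.trace.map label = y := by
  induction D using Quot.ind with
  | mk L => exact L.2.map_label_run (map_label_map_base x)

theorem trace_sum (D : P.Diagram x y) (E : P.Diagram x' y') :
    (D.sum E).trace = D.trace ++ E.trace := by
  obtain ⟨L, hL, rfl⟩ := D.exists_ofDerivation
  obtain ⟨M, hM, rfl⟩ := E.exists_ofDerivation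
  change run ((x ++ x').map base) (L.map (DerivStep.addRight x') ++ M.map (DerivStep.addLeft y)) =
    run (x.map base) L ++ run (x'.map base) M
  rw [List.map_append, run_append, hL.run_addRight (map_label_map_base x),
    hM.run_addLeft (map_label_map_base x') (hL.map_label_run (map_label_map_base x))]

theorem ReducesDipole.trace_eq (h : D.ReducesDipole E) : D.trace = E.trace := by
  obtain ⟨z, t, D₁, A, D₂, hA, rfl, rfl⟩ := h
  obtain ⟨L, hL, rfl⟩ := D₁.exists_ofDerivation
  obtain ⟨M, hM, rfl⟩ := D₂.exists_ofDerivation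
  obtain ⟨e, he, rfl⟩ := exists_ofDerivation_singleton hA
  have hdipole : P.IsDerivation x (L ++ e :: e.inv :: M) y := by
    simpa using (hL.append (he.append he.mirror)).append hM
  change run (x.map base) (L ++ ([e] ++ [e.inv]) ++ M) = run (x.map base) (L ++ M)
  simpa using hdipole.run_append_dipole

theorem IsReduced.eq_of_trace_eq (hD : D.IsReduced) (hE : E.IsReduced)
    (h : D.trace = E.trace) : D = E := by
  obtain ⟨L, hL, rfl⟩ := D.exists_ofDerivation
  obtain ⟨M, hM, rfl⟩ := E.exists_ofDerivation
  exact (ofDerivation_eq_iff hL hM).2 (hL.isotopic_of_run_eq hM hD.hasNoDipole hE.hasNoDipole h)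

end Diagram

namespace DiagramClass

/-- The tracked bottom word of a diagram, as an invariant of the diagram modulo reduction of
dipoles. -/
noncomputable def trace (g : P.DiagramClass x y) : List (TrackedLetter α) :=
  Quot.lift Diagram.trace (fun _ _ h => h.trace_eq) g

theorem trace_sum (g : P.DiagramClass x y) (h : P.DiagramClass x' y') :
    (g.sum h).trace = g.trace ++ h.trace := by
  induction g using Quot.ind
  induction h using Quot.ind
  exact Diagram.trace_sum _ _

theorem length_trace (g : P.DiagramClass x y) : g.trace.length = y.length := by
  induction g using Quot.ind with
  | mk D => exact (List.length_map label).symm.trans (congrArg List.length D.map_label_trace)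

theorem trace_injective : Function.Injective (trace : P.DiagramClass x y → _) := by
  intro g h hgh
  induction g using Quot.ind with | mk D =>
  induction h using Quot.ind with | mk E =>
  obtain ⟨D', hD', hD⟩ := D.exists_isReduced
  obtain ⟨E', hE', hE⟩ := E.exists_isReduced
  have htrace : D'.trace = E'.trace :=
    (congrArg trace hD).trans (hgh.trans (congrArg trace hE).symm)
  exact hD.symm.trans ((congrArg Diagram.toClass (hD'.eq_of_trace_eq hE' htrace)).trans hE)

theorem sum_inj {g g' : P.DiagramClass x y} {h h' : P.DiagramClass x' y'} :
    g.sum h = g'.sum h' ↔ g = g' ∧ h = h' := by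
  refine ⟨fun heq => ?_, fun ⟨hg, hh⟩ => hg ▸ hh ▸ rfl⟩
  have htrace := congrArg trace heq
  rw [trace_sum, trace_sum] at htrace
  obtain ⟨hg, hh⟩ := List.append_inj htrace ((length_trace g).trans (length_trace g').symm)
  exact ⟨trace_injective hg, trace_injective hh⟩

@[elab_as_elim]
theorem stepInduction {motive : ∀ {y : List α}, P.DiagramClass x y → Prop}
    (trivial : motive (Diagram.trivial P x).toClass)
    (comp : ∀ {y z : List α} (g : P.DiagramClass x y) {e : DerivStep α}
      (h : P.IsDerivation y [e] z), motive g → motive (g.comp (Diagram.ofDerivation h).toClass))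
    (g : P.DiagramClass x y) : motive g := by
  induction g using Quot.ind with | mk D =>
  obtain ⟨L, hL, rfl⟩ := D.exists_ofDerivation
  induction L using List.reverseRecOn generalizing y with
  | nil =>
    cases hL
    exact trivial
  | append_singleton L e ih =>
    obtain ⟨z, hL, he⟩ := isDerivation_append.1 hL
    exact comp (Diagram.ofDerivation hL).toClass he (ih hL)

theorem comp_left_cancel (g : P.DiagramClass x y) {h k : P.DiagramClass y z}
    (hgk : g.comp h = g.comp k) : h = k := by
  have := congrArg g.inv.comp hgk
  rwa [← comp_assoc, ← comp_assoc, inv_comp, trivial_comp, trivial_comp] at this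

end DiagramClass

theorem Diagram.IsReduced.eq_of_toClass_eq {D E : P.Diagram x y} (hD : D.IsReduced)
    (hE : E.IsReduced) (h : D.toClass = E.toClass) : D = E :=
  hD.eq_of_trace_eq hE (congrArg DiagramClass.trace h)

theorem canonicalHom_injective (a u b : List α) : Function.Injective (P.canonicalHom a u b) := by
  rintro ⟨A, B⟩ ⟨A', B'⟩ h
  obtain ⟨hA, hB⟩ := DiagramClass.sum_inj.1 h
  exact Prod.ext (DiagramClass.sum_inj.1 hA).1 hB

/-! ### Squares of the Farley complex -/

theorem Diagram.sum_trivial (D : P.Diagram x y) (z : List α) :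
    D.sum (.trivial P z) = D.addTrivial z :=
  Diagram.comp_trivial (D.addTrivial z)

theorem Diagram.trivial_sum (D : P.Diagram x y) (z : List α) :
    (Diagram.trivial P z).sum D = Diagram.trivialAdd z D :=
  Diagram.trivial_comp (Diagram.trivialAdd z D)

theorem Diagram.toClass_comp (D : P.Diagram x y) (E : P.Diagram y z) :
    (D.comp E).toClass = D.toClass.comp E.toClass := rfl

variable {w : List α}

namespace FarleyVertex

variable {V W V' W' : P.FarleyVertex w} {s t s' t' : DerivStep α}

/-- `W = V · A`, where `A` is the atomic diagram drawn by `e`. -/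
def Step (V : P.FarleyVertex w) (e : DerivStep α) (W : P.FarleyVertex w) : Prop :=
  ∃ h : P.IsDerivation V.1 [e] W.1, W.2 = V.2.comp (Diagram.ofDerivation h).toClass

namespace Step

theorem unique (h : V.Step e W) (h' : V.Step e W') : W = W' := by
  obtain ⟨y, W⟩ := W
  obtain ⟨y', W'⟩ := W'
  obtain ⟨hy, hW⟩ := h
  obtain ⟨hy', hW'⟩ := h'
  obtain rfl : y = y' :=
    (isDerivation_singleton.1 hy).2.2.trans (isDerivation_singleton.1 hy').2.2.symm
  exact congrArg (Sigma.mk y) (hW.trans hW'.symm)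

theorem step_unique (he : V.Step e W) (hf : V.Step f W) : e = f := by
  obtain ⟨he, hW⟩ := he
  obtain ⟨hf, hW'⟩ := hf
  have hdiagram : Diagram.ofDerivation he = Diagram.ofDerivation hf :=
    (Diagram.isReduced_of_numCells_eq_one rfl).eq_of_toClass_eq
      (Diagram.isReduced_of_numCells_eq_one rfl) (V.2.comp_left_cancel (hW.symm.trans hW'))
  exact List.singleton_inj.1
    (((Diagram.ofDerivation_eq_iff he hf).1 hdiagram).eq_of_length_eq_one rfl)

theorem symm (h : V.Step e W) : W.Step e.inv V := by
  obtain ⟨h, hW⟩ := h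
  refine ⟨h.mirror, ?_⟩
  change V.2 = W.2.comp (Diagram.ofDerivation h).toClass.inv
  rw [hW, DiagramClass.comp_assoc, DiagramClass.comp_inv, DiagramClass.comp_trivial]

theorem smul (h : V.Step e W) (g : P.DiagramGroup w) : (g • V).Step e (g • W) := by
  obtain ⟨h, hW⟩ := h
  refine ⟨h, ?_⟩
  change g.comp W.2 = (g.comp V.2).comp _
  rw [hW, DiagramClass.comp_assoc]

end Step

theorem step_sum_trivial (V : P.DiagramClass w (x ++ z)) (h : P.IsDerivation x [e] y) :
    Step (⟨_, V⟩ : P.FarleyVertex w) (e.addRight z)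
      ⟨_, V.comp ((Diagram.ofDerivation h).sum (.trivial P z)).toClass⟩ :=
  ⟨h.addRight z, by rw [Diagram.sum_trivial]; rfl⟩

theorem step_trivial_sum (V : P.DiagramClass w (z ++ x)) (h : P.IsDerivation x [e] y) :
    Step (⟨_, V⟩ : P.FarleyVertex w) (e.addLeft z)
      ⟨_, V.comp ((Diagram.trivial P z).sum (Diagram.ofDerivation h)).toClass⟩ :=
  ⟨h.addLeft z, by rw [Diagram.trivial_sum]; rfl⟩

/-- `V`, `W`, `V'`, `W'` are the corners of a square of the Farley complex, whose sides `[V, W]`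
and `[V', W']` are traversed by the steps `s` and `s'`, and whose sides `[V, V']` and `[W, W']` are
traversed by the steps `t` and `t'`. -/
structure IsSquare (s t s' t' : DerivStep α) (V W V' W' : P.FarleyVertex w) : Prop where
  independent : Independent s t s' t'
  top : V.Step s W
  left : V.Step t V'
  bottom : V'.Step s' W'
  right : W.Step t' W'

namespace IsSquare

theorem swap (h : IsSquare s t s' t' V W V' W') : IsSquare t s t' s' V V' W W' :=
  ⟨h.independent.symm, h.left, h.top, h.right, h.bottom⟩

theorem inv_right (h : IsSquare s t s' t' V W V' W') : IsSquare s' t.inv s t'.inv V' W' V W :=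
  ⟨h.independent.inv_right, h.bottom, h.left.symm, h.top, h.right.symm⟩

theorem inv_left (h : IsSquare s t s' t' V W V' W') : IsSquare s.inv t' s'.inv t W V W' V' :=
  h.swap.inv_right.swap

theorem smul (h : IsSquare s t s' t' V W V' W') (g : P.DiagramGroup w) :
    IsSquare s t s' t' (g • V) (g • W) (g • V') (g • W') :=
  ⟨h.independent, h.top.smul g, h.left.smul g, h.bottom.smul g, h.right.smul g⟩

end IsSquare

theorem isSquare_sum (V : P.DiagramClass w (x ++ x')) (hs : P.IsDerivation x [s] y)
    (ht : P.IsDerivation x' [t] y') :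
    IsSquare (s.addRight x') (t.addLeft x) (s.addRight y') (t.addLeft y) ⟨_, V⟩
      ⟨_, V.comp ((Diagram.ofDerivation hs).sum (.trivial P x')).toClass⟩
      ⟨_, V.comp ((Diagram.trivial P x).sum (Diagram.ofDerivation ht)).toClass⟩
      ⟨_, V.comp ((Diagram.ofDerivation hs).sum (Diagram.ofDerivation ht)).toClass⟩ where
  independent := by
    obtain ⟨-, rfl, rfl⟩ := isDerivation_singleton.1 hs
    obtain ⟨-, rfl, rfl⟩ := isDerivation_singleton.1 ht
    exact .left s t
  top := step_sum_trivial V hs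
  left := step_trivial_sum V ht
  bottom := by
    have h := step_sum_trivial
      (V.comp ((Diagram.trivial P x).sum (Diagram.ofDerivation ht)).toClass) hs
    rwa [DiagramClass.comp_assoc, ← Diagram.toClass_comp, Diagram.sum_comp_sum,
      Diagram.trivial_comp, Diagram.comp_trivial] at h
  right := by
    have h := step_trivial_sum
      (V.comp ((Diagram.ofDerivation hs).sum (.trivial P x')).toClass) ht
    rwa [DiagramClass.comp_assoc, ← Diagram.toClass_comp, Diagram.sum_comp_sum,
      Diagram.trivial_comp, Diagram.comp_trivial] at h

end FarleyVertex

open FarleyVertex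

theorem Parallel.exists_isSquare {p q : Sym2 (P.FarleyVertex w)} (h : Parallel w p q) :
    ∃ s t s' t' V W V' W', IsSquare s t s' t' V W V' W' ∧ p = s(V, W) ∧ q = s(V', W') := by
  cases h with
  | left V A B hA hB =>
    obtain ⟨s, hs, rfl⟩ := Diagram.exists_ofDerivation_singleton hA
    obtain ⟨t, ht, rfl⟩ := Diagram.exists_ofDerivation_singleton hB
    exact ⟨_, _, _, _, _, _, _, _, isSquare_sum V hs ht, rfl, rfl⟩
  | right V A B hA hB =>
    obtain ⟨s, hs, rfl⟩ := Diagram.exists_ofDerivation_singleton hA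
    obtain ⟨t, ht, rfl⟩ := Diagram.exists_ofDerivation_singleton hB
    exact ⟨_, _, _, _, _, _, _, _, (isSquare_sum V hs ht).swap, rfl, rfl⟩

namespace FarleyVertex

variable {V W V' W' : P.FarleyVertex w} {s t s' t' : DerivStep α}

theorem IsSquare.parallel (h : IsSquare s t s' t' V W V' W') :
    Parallel w s(V, W) s(V', W') := by
  have parallel_of_left {s t : DerivStep α} {V W V' W' : P.FarleyVertex w}
      (h : IsSquare (s.addRight t.source) (t.addLeft s.source) (s.addRight t.target)
        (t.addLeft s.target) V W V' W') :
      Parallel w s(V, W) s(V', W') ∧ Parallel w s(V, V') s(W, W') := by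
    obtain ⟨x, V⟩ := V
    obtain ⟨hs, hx, -⟩ := isDerivation_singleton.1 h.top.1
    obtain ⟨ht, -, -⟩ := isDerivation_singleton.1 h.left.1
    obtain rfl : x = s.source ++ t.source := by simpa [source, addRight] using hx
    replace hs : P.IsDerivation s.source [s] s.target := ⟨hs, rfl, rfl⟩
    replace ht : P.IsDerivation t.source [t] t.target := ⟨ht, rfl, rfl⟩
    have hsquare := isSquare_sum V hs ht
    obtain rfl := h.top.unique hsquare.top
    obtain rfl := h.left.unique hsquare.left
    obtain rfl := h.bottom.unique hsquare.bottom
    exact ⟨.left V _ _ rfl rfl, .right V _ _ rfl rfl⟩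
  cases h.independent with
  | left s t => exact (parallel_of_left h).1
  | right s t => exact (parallel_of_left h.swap).2

end FarleyVertex

theorem Parallel.symm {p q : Sym2 (P.FarleyVertex w)} (h : Parallel w p q) : Parallel w q p := by
  obtain ⟨s, t, s', t', V, W, V', W', hsquare, rfl, rfl⟩ := h.exists_isSquare
  exact hsquare.inv_right.parallel

theorem Parallel.exists_isSquare_of_step {V W : P.FarleyVertex w} {q : Sym2 (P.FarleyVertex w)}
    (h : Parallel w s(V, W) q) (hV : V.Step e W) :
    ∃ t e' t' V' W', IsSquare e t e' t' V W V' W' ∧ q = s(V', W') := by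
  obtain ⟨s, t, s', t', V₁, W₁, V', W', hsquare, hVW, rfl⟩ := h.exists_isSquare
  rcases Sym2.eq_iff.1 hVW with ⟨rfl, rfl⟩ | ⟨rfl, rfl⟩
  · obtain rfl := hV.step_unique hsquare.top
    exact ⟨_, _, _, _, _, hsquare, rfl⟩
  · obtain rfl := hV.step_unique hsquare.inv_left.top
    exact ⟨_, _, _, _, _, hsquare.inv_left, Sym2.eq_swap⟩

theorem eqvGen_parallel_smul (g : P.DiagramGroup w) {p q : Sym2 (P.FarleyVertex w)}
    (h : Relation.EqvGen (Parallel w) p q) :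
    Relation.EqvGen (Parallel w) (p.map (g • ·)) (q.map (g • ·)) := by
  induction h with
  | rel _ _ h =>
    obtain ⟨s, t, s', t', V, W, V', W', hsquare, rfl, rfl⟩ := h.exists_isSquare
    exact .rel _ _ (hsquare.smul g).parallel
  | refl => exact .refl _
  | symm _ _ _ ih => exact ih.symm
  | trans _ _ _ _ _ ih ih' => exact ih.trans _ _ _ ih'

theorem IsHyperplane.eq_setOf_eqvGen {J : Set (Sym2 (P.FarleyVertex w))} (hJ : IsHyperplane J)
    {p : Sym2 (P.FarleyVertex w)} (hp : p ∈ J) : J = {q | Relation.EqvGen (Parallel w) p q} := by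
  obtain ⟨p₀, -, rfl⟩ := hJ
  ext q
  exact ⟨(Relation.EqvGen.symm _ _ hp).trans _ _ _, Relation.EqvGen.trans _ _ _ hp⟩

theorem IsHyperplane.mem_hyperplaneStabilizer_iff {J : Set (Sym2 (P.FarleyVertex w))}
    (hJ : IsHyperplane J) {p : Sym2 (P.FarleyVertex w)} (hp : p ∈ J) {g : P.DiagramGroup w} :
    g ∈ hyperplaneStabilizer J ↔ p.map (g • ·) ∈ J := by
  refine ⟨fun hg => ?_, fun hg => ?_⟩
  · replace hg : Sym2.map (g • ·) '' J = J := hg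
    exact hg ▸ Set.mem_image_of_mem _ hp
  · have map_inv_map (q : Sym2 (P.FarleyVertex w)) : (q.map (g⁻¹ • ·)).map (g • ·) = q := by
      simp [Sym2.map_map]
    have hJp := hJ.eq_setOf_eqvGen hp
    have hJgp := hJ.eq_setOf_eqvGen hg
    change Sym2.map (g • ·) '' J = J
    refine Set.Subset.antisymm ?_ fun q hq => ?_
    · rintro _ ⟨q, hq, rfl⟩
      rw [hJp] at hq
      rw [hJgp]
      exact eqvGen_parallel_smul g hq
    · refine ⟨q.map (g⁻¹ • ·), ?_, map_inv_map q⟩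
      rw [hJgp] at hq
      rw [hJp]
      simpa [Sym2.map_map, Function.comp_def] using eqvGen_parallel_smul g⁻¹ hq

theorem edge_mem_of_isHalfspace_upperSet {J : Set (Sym2 (P.FarleyVertex w))}
    {D : P.Diagram w x} {A : P.Diagram x y} (hA : A.numCells = 1)
    (hred : (D.comp A).IsReduced) (hJ : IsHalfspace J (D.comp A).upperSet) :
    s(D.toVertex, (D.comp A).toVertex) ∈ J := by
  obtain ⟨C, hC⟩ := hJ
  by_contra hmem
  have hadj : ((P.farleyGraph w).deleteEdges J).Adj D.toVertex (D.comp A).toVertex :=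
    SimpleGraph.deleteEdges_adj.2 ⟨⟨A, hA, rfl⟩, hmem⟩
  have hDA : (D.comp A).toVertex ∈ C.supp :=
    hC ▸ ⟨D.comp A, hred, rfl, .trivial P _, (Diagram.comp_trivial _).symm⟩
  have hD : D.toVertex ∈ (D.comp A).upperSet :=
    hC ▸ (SimpleGraph.ConnectedComponent.sound hadj.reachable).trans hDA
  obtain ⟨_, hred', hclass, E, rfl⟩ := hD
  have hcells : (D.comp A).numCells + E.numCells = D.numCells :=
    (Diagram.numCells_comp _ _).symm.trans
      (congrArg Diagram.numCells (hred'.eq_of_toClass_eq hred.of_comp hclass))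
  rw [Diagram.numCells_comp] at hcells
  omega

/-! ### The hyperplane of an edge -/

section Flanked

variable {a u v b a' u' b' a'' u'' b'' : List α}

/-- The vertex `D · (A + C + B)`. -/
def flanked (D : P.DiagramClass w (a ++ u ++ b)) (A : P.DiagramClass a a')
    (C : P.DiagramClass u u') (B : P.DiagramClass b b') : P.FarleyVertex w :=
  ⟨a' ++ u' ++ b', D.comp ((A.sum C).sum B)⟩

section Step

variable (D : P.DiagramClass w (a ++ u ++ b)) (A : P.DiagramClass a a')
  (C : P.DiagramClass u u') (B : P.DiagramClass b b')

theorem flanked_step {A' : P.Diagram a' a''} {C' : P.Diagram u' u''} {B' : P.Diagram b' b''}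
    {h : P.IsDerivation (a' ++ u' ++ b') [e] (a'' ++ u'' ++ b'')}
    (hsum : Diagram.ofDerivation h = (A'.sum C').sum B') :
    (flanked D A C B).Step e
      (flanked D (A.comp A'.toClass) (C.comp C'.toClass) (B.comp B'.toClass)) := by
  have hclass : (Diagram.ofDerivation h).toClass = (A'.toClass.sum C'.toClass).sum B'.toClass :=
    congrArg Diagram.toClass hsum
  refine ⟨h, ?_⟩
  change D.comp _ = (D.comp _).comp (Diagram.ofDerivation h).toClass
  rw [hclass, DiagramClass.comp_assoc, DiagramClass.sum_comp_sum, DiagramClass.sum_comp_sum]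

theorem flanked_step_cell (hcell : P.IsCell u v) :
    (flanked D A (Diagram.trivial P u).toClass B).Step ⟨a', u, v, b'⟩
      (flanked D A (Diagram.cell hcell).toClass B) := by
  have h : P.IsDerivation (a' ++ u ++ b') [⟨a', u, v, b'⟩] (a' ++ v ++ b') := ⟨hcell, rfl, rfl⟩
  have hsum : Diagram.ofDerivation h =
      ((Diagram.trivial P a').sum (.cell hcell)).sum (.trivial P b') := by
    rw [Diagram.sum_trivial, Diagram.trivial_sum]
    exact Diagram.ofDerivation_congr h (by simp [addLeft, addRight])
  simpa only [DiagramClass.comp_trivial, DiagramClass.trivial_comp] using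
    flanked_step D A (Diagram.trivial P u).toClass B hsum

theorem flanked_step_left (h : P.IsDerivation a' [e] a'') :
    (flanked D A C B).Step (e.addRight (u' ++ b'))
      (flanked D (A.comp (Diagram.ofDerivation h).toClass) C B) := by
  have h' : P.IsDerivation (a' ++ u' ++ b') [e.addRight (u' ++ b')] (a'' ++ u' ++ b') := by
    simpa using h.addRight (u' ++ b')
  have hsum : Diagram.ofDerivation h' =
      ((Diagram.ofDerivation h).sum (.trivial P u')).sum (.trivial P b') := by
    rw [Diagram.sum_trivial, Diagram.sum_trivial]
    exact Diagram.ofDerivation_congr h' (by simp [addRight])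
  simpa only [DiagramClass.comp_trivial] using flanked_step D A C B hsum

theorem flanked_step_right (h : P.IsDerivation b' [e] b'') :
    (flanked D A C B).Step (e.addLeft (a' ++ u'))
      (flanked D A C (B.comp (Diagram.ofDerivation h).toClass)) := by
  have hsum : Diagram.ofDerivation (h.addLeft (a' ++ u')) =
      ((Diagram.trivial P a').sum (.trivial P u')).sum (Diagram.ofDerivation h) :=
    (Diagram.trivial_sum (Diagram.ofDerivation h) (a' ++ u')).symm
  simpa only [DiagramClass.comp_trivial] using flanked_step D A C B hsum

theorem isSquare_flanked_left (hcell : P.IsCell u v) (h : P.IsDerivation a' [e] a'') :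
    IsSquare ⟨a', u, v, b'⟩ (e.addRight (u ++ b')) ⟨a'', u, v, b'⟩ (e.addRight (v ++ b'))
      (flanked D A (Diagram.trivial P u).toClass B) (flanked D A (Diagram.cell hcell).toClass B)
      (flanked D (A.comp (Diagram.ofDerivation h).toClass) (Diagram.trivial P u).toClass B)
      (flanked D (A.comp (Diagram.ofDerivation h).toClass) (Diagram.cell hcell).toClass B) where
  independent := by
    obtain ⟨-, rfl, rfl⟩ := isDerivation_singleton.1 h
    simpa [source, target, addLeft] using Independent.right e ⟨[], u, v, b'⟩
  top := flanked_step_cell D A B hcell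
  left := flanked_step_left D A _ B h
  bottom := flanked_step_cell D _ B hcell
  right := flanked_step_left D A _ B h

theorem isSquare_flanked_right (hcell : P.IsCell u v) (h : P.IsDerivation b' [e] b'') :
    IsSquare ⟨a', u, v, b'⟩ (e.addLeft (a' ++ u)) ⟨a', u, v, b''⟩ (e.addLeft (a' ++ v))
      (flanked D A (Diagram.trivial P u).toClass B) (flanked D A (Diagram.cell hcell).toClass B)
      (flanked D A (Diagram.trivial P u).toClass (B.comp (Diagram.ofDerivation h).toClass))
      (flanked D A (Diagram.cell hcell).toClass (B.comp (Diagram.ofDerivation h).toClass)) where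
  independent := by
    obtain ⟨-, rfl, rfl⟩ := isDerivation_singleton.1 h
    simpa [source, target, addRight] using Independent.left ⟨a', u, v, []⟩ e
  top := flanked_step_cell D A B hcell
  left := flanked_step_right D A _ B h
  bottom := flanked_step_cell D A _ hcell
  right := flanked_step_right D A _ B h

end Step

/-- The edge `[D · (A + ε(u) + B), D · (A + Π + B)]`, where `Π` is the cell given by `hcell`. -/
def flankedEdge (D : P.DiagramClass w (a ++ u ++ b)) (hcell : P.IsCell u v)
    (A : P.DiagramClass a a') (B : P.DiagramClass b b') : Sym2 (P.FarleyVertex w) :=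
  s(flanked D A (Diagram.trivial P u).toClass B, flanked D A (Diagram.cell hcell).toClass B)

/-- The edges `[D · (A + ε(u) + B), D · (A + Π + B)]` for arbitrary diagrams `A` and `B`; they turn
out to form the hyperplane of the edge `[D, D · (ε(a) + Π + ε(b))]`. -/
def flankedEdges (D : P.DiagramClass w (a ++ u ++ b)) (hcell : P.IsCell u v) :
    Set (Sym2 (P.FarleyVertex w)) :=
  {p | ∃ (a' b' : List α) (A : P.DiagramClass a a') (B : P.DiagramClass b b'),
    p = flankedEdge D hcell A B}

variable {D : P.DiagramClass w (a ++ u ++ b)} {hcell : P.IsCell u v}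
  {p q : Sym2 (P.FarleyVertex w)}

theorem Parallel.mem_flankedEdges (h : Parallel w p q) (hp : p ∈ flankedEdges D hcell) :
    q ∈ flankedEdges D hcell := by
  obtain ⟨a', b', A, B, rfl⟩ := hp
  obtain ⟨t, s', t', V', W', hsquare, rfl⟩ :=
    h.exists_isSquare_of_step (flanked_step_cell D A B hcell)
  have ht : P.IsCell t.top t.bot := (isDerivation_singleton.1 hsquare.left.1).1
  rcases hsquare.independent.exists_addRight_or_exists_addLeft with
    ⟨e, rfl, rfl, rfl⟩ | ⟨e, rfl, rfl, rfl⟩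
  · have he : P.IsDerivation e.source [e] e.target := ⟨ht, rfl, rfl⟩
    have hflanked := isSquare_flanked_left D A B hcell he
    obtain rfl := hsquare.left.unique hflanked.left
    obtain rfl := hsquare.bottom.unique hflanked.bottom
    exact ⟨_, _, _, _, rfl⟩
  · have he : P.IsDerivation e.source [e] e.target := ⟨ht, rfl, rfl⟩
    have hflanked := isSquare_flanked_right D A B hcell he
    obtain rfl := hsquare.left.unique hflanked.left
    obtain rfl := hsquare.bottom.unique hflanked.bottom
    exact ⟨_, _, _, _, rfl⟩

theorem mem_flankedEdges_iff_of_eqvGen (h : Relation.EqvGen (Parallel w) p q) :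
    p ∈ flankedEdges D hcell ↔ q ∈ flankedEdges D hcell := by
  induction h with
  | rel _ _ h => exact ⟨h.mem_flankedEdges, h.symm.mem_flankedEdges⟩
  | refl => rfl
  | symm _ _ _ ih => exact ih.symm
  | trans _ _ _ _ _ ih ih' => exact ih.trans ih'

theorem eqvGen_parallel_flankedEdge (D : P.DiagramClass w (a ++ u ++ b)) (hcell : P.IsCell u v)
    (A : P.DiagramClass a a') (B : P.DiagramClass b b') :
    Relation.EqvGen (Parallel w)
      (flankedEdge D hcell (Diagram.trivial P a).toClass (Diagram.trivial P b).toClass)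
      (flankedEdge D hcell A B) := by
  induction B using DiagramClass.stepInduction with
  | trivial =>
    induction A using DiagramClass.stepInduction with
    | trivial => exact .refl _
    | comp A h ih =>
      exact ih.trans _ _ _ (.rel _ _ (isSquare_flanked_left D A _ hcell h).parallel)
  | comp B h ih => exact ih.trans _ _ _ (.rel _ _ (isSquare_flanked_right D A B hcell h).parallel)

theorem IsHyperplane.eq_flankedEdges {J : Set (Sym2 (P.FarleyVertex w))} (hJ : IsHyperplane J)
    (hmem : flankedEdge D hcell (Diagram.trivial P a).toClass (Diagram.trivial P b).toClass ∈ J) :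
    J = flankedEdges D hcell := by
  rw [hJ.eq_setOf_eqvGen hmem]
  ext p
  refine ⟨fun hp => (mem_flankedEdges_iff_of_eqvGen hp).1 ⟨_, _, _, _, rfl⟩, ?_⟩
  rintro ⟨a', b', A, B, rfl⟩
  exact eqvGen_parallel_flankedEdge D hcell A B

theorem smul_edge_mem_flankedEdges_iff {D : P.Diagram w (a ++ u ++ b)} {hcell : P.IsCell u v}
    {W : P.FarleyVertex w} (hW : D.toVertex.Step ⟨a, u, v, b⟩ W) {g : P.DiagramGroup w} :
    s(g • D.toVertex, g • W) ∈ flankedEdges D.toClass hcell ↔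
      ∃ k, g.comp D.toClass = D.toClass.comp (P.canonicalHom a u b k) := by
  have hgW := hW.smul g
  constructor
  · rintro ⟨a', b', A, B, hp⟩
    have hstep := flanked_step_cell D.toClass A B hcell
    rcases Sym2.eq_iff.1 hp with ⟨hV, hW'⟩ | ⟨hV, hW'⟩
    · rw [hV, hW'] at hgW
      cases hgW.step_unique hstep
      exact ⟨(A, B), eq_of_heq (Sigma.mk.inj hV).2⟩
    · rw [hV, hW'] at hgW
      exact absurd (congrArg DerivStep.top (hgW.step_unique hstep.symm)) hcell.ne
  · rintro ⟨⟨A, B⟩, hg⟩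
    have hV : g • D.toVertex = flanked D.toClass A (Diagram.trivial P u).toClass B :=
      congrArg (Sigma.mk _) hg
    rw [hV] at hgW
    refine ⟨a, b, A, B, ?_⟩
    rw [flankedEdge, hV, hgW.unique (flanked_step_cell D.toClass A B hcell)]

end Flanked

theorem mem_map_conjHom_iff (D : P.Diagram w z) (H : Subgroup (P.DiagramGroup z))
    {g : P.DiagramGroup w} :
    g ∈ H.map (conjHom D) ↔ ∃ k ∈ H, g.comp D.toClass = D.toClass.comp k := by
  have conjHom_eq_iff (k : P.DiagramGroup z) :
      conjHom D k = g ↔ g.comp D.toClass = D.toClass.comp k := by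
    change (D.toClass.comp k).comp D.toClass.inv = g ↔ _
    constructor
    · rintro rfl
      rw [DiagramClass.comp_assoc, DiagramClass.inv_comp, DiagramClass.comp_trivial]
    · intro h
      rw [← h, DiagramClass.comp_assoc, DiagramClass.comp_inv, DiagramClass.comp_trivial]
  simp only [Subgroup.mem_map, conjHom_eq_iff]

end SemigroupPresentation

open SemigroupPresentation in
theorem proposition2p6_general {α : Type*} (P : SemigroupPresentation α) (w : List α)
    (J : Set (Sym2 (P.FarleyVertex w))) (hJ : IsHyperplane J) (a u v b : List α)
    (hcell : P.IsCell u v) (D : P.Diagram w (a ++ u ++ b))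
    (hmem : s(D.toVertex,
      (D.comp (((Diagram.trivial P a).sum (.cell hcell)).sum (.trivial P b))).toVertex) ∈ J) :
    Function.Injective (P.canonicalHom a u b) ∧
      hyperplaneStabilizer J = (P.canonicalHom a u b).range.map (conjHom D) := by
  refine ⟨canonicalHom_injective a u b, ?_⟩
  have hvertex : flanked D.toClass (Diagram.trivial P a).toClass (Diagram.trivial P u).toClass
      (Diagram.trivial P b).toClass = D.toVertex :=
    congrArg (Sigma.mk _) (DiagramClass.comp_trivial D.toClass)
  have hstep := hvertex ▸ flanked_step_cell D.toClass (Diagram.trivial P a).toClass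
    (Diagram.trivial P b).toClass hcell
  have hedges : J = flankedEdges D.toClass hcell := by
    refine hJ.eq_flankedEdges ?_
    rw [flankedEdge, hvertex]
    exact hmem
  ext g
  rw [hJ.mem_hyperplaneStabilizer_iff hmem, hedges]
  rw [mem_map_conjHom_iff]
  refine (smul_edge_mem_flankedEdges_iff hstep).trans ?_
  simp only [MonoidHom.mem_range, exists_exists_eq_and]

theorem proposition2p6 {α : Type*} (P : SemigroupPresentation α) (w : List α) (hw : w ≠ [])
    (J : Set (Sym2 (P.FarleyVertex w))) (hJ : SemigroupPresentation.IsHyperplane J)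
    (a u v b : List α) (hcell : P.IsCell u v)
    (Δ : P.Diagram w (a ++ v ++ b)) (hΔ : SemigroupPresentation.IsMinimalDiagramOf J Δ)
    (F : P.Diagram (a ++ u ++ b) (a ++ v ++ b))
    (hF : F = ((SemigroupPresentation.Diagram.trivial P a).sum
      (SemigroupPresentation.Diagram.cell hcell)).sum (SemigroupPresentation.Diagram.trivial P b))
    (hmax : F.IsMaximalThinSuffix Δ)
    (Δbar : P.Diagram w (a ++ u ++ b)) (hΔbar : Δ = Δbar.comp F)
    (ha : ∀ ξ : List α, ξ ≠ [] → ¬ P.EqMod a (a ++ u ++ ξ)) :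
    Function.Injective (P.canonicalHom a u b) ∧
      SemigroupPresentation.hyperplaneStabilizer J =
        (P.canonicalHom a u b).range.map (SemigroupPresentation.conjHom Δbar) := by
  subst hF hΔbar
  exact proposition2p6_general P w J hJ a u v b hcell Δbar
    (SemigroupPresentation.edge_mem_of_isHalfspace_upperSet rfl hΔ.1 hΔ.2.2.1)
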